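/- Let $d$ be a prime, let $\mathsf H=\mathbb C^d$ with orthonormal basis $|0\rangle,\dots,|d-1\rangle$, let $\omega$ be a primitive $d$-th root of unity, and define $X|j\rangle=|(j-1)\bmod d\rangle$, $Z|j\rangle=\omega^j|j\rangle$. Put $\mathcal X=\{0,\dots,d-1\}^2$, $N_{(i,j)}=X^iZ^j$, and $N_x=N_{x_1}\otimes\cdots\otimes N_{x_n}$ for $x\in\mathcal X^n$. Let $p$ be a probability distribution on $\mathcal X$, let $P(v|u)$, $u,v\in\mathcal X$, be transition probabilities, put $P_n(x)=p(x_1)\prod_{j=1}^{n-1}P(x_{j+1}|x_j)$, and let $\mathcal A_n$ be the channel on operators on $\mathsf H^{\otimes n}$ given by $\mathcal A_n(\rho)=\sum_{x\in\mathcal X^n}P_n(x)\,N_x\rho N_x^\dagger$. For real $k\ge 0$ let $F^\star_{n,k}(\mathcal A_n)$ be the supremum, over all subspaces $\mathcal C\subseteq\mathsf H^{\otimes n}$ with $\log_d\dim\mathcal C\ge k$ and all trace-preserving completely positive linear maps $\mathcal R$ on operators on $\mathsf H^{\otimes n}$, of the minimum of $\langle\psi|\mathcal R(\mathcal A_n(|\psi\rangle\langle\psi|))|\psi\rangle$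 over unit vectors $\psi\in\mathcal C$. The quantum capacity of $\{\mathcal A_n\}$ is the supremum of all $R\ge 0$ with $\lim_{n\to\infty}F^\star_{n,Rn}(\mathcal A_n)=1$. For a probability distribution $Q$ on $\mathcal X^2$ let $\bar Q(u)=\sum_vQ(u,v)$, $\bar{\bar Q}(u)=\sum_vQ(v,u)$, $\overleftarrow Q(v|u)=Q(u,v)/\bar Q(u)$ where $\bar Q(u)>0$, and $$D(Q\|P)=\sum_{u:\bar Q(u)>0}\sum_vQ(u,v)\log_d\frac{\overleftarrow Q(v|u)}{P(v|u)},\qquad H(P|q)=-\sum_{u:q(u)>0}\sum_v q(u)P(v|u)\log_dP(v|u),$$ with $\log(a/0)=\infty$ for $a>0$ and $0\log0=0\log(0/0)=0$, and let $$E(R,P)=\min_{Q:\,\bar Q=\bar{\bar Q}}\bigl[D(Q\|P)+\max\{1-H(\overleftarrow Q|\bar Q)-R,\,0\}\bigr],$$ where $Q$ ranges over probability distributions on $\mathcal X^2$. Suppose that the Markov chain with transition probabilities $P$ is irreducible. Then it has a unique stationary distribution $q$, and: 1. for every probability distribution $Q$ on $\mathcal X^2$ with $\bar Q=\bar{\bar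 Q}$, $D(Q\|P)\ge0$, with equality if and only if $Q(u,v)=q(u)P(v|u)$ for all $u,v\in\mathcal X$; 2. $E(R,P)>0$ for every real $R<1-H(P|q)$; 3. the quantum capacity of $\{\mathcal A_n\}$ is at least $1-H(P|q)$. -/

import Mathlib

open Filter Topology Matrix
open scoped ComplexOrder

noncomputable section

namespace MarkovChannel

/-! ### Quantum operations, codes, fidelity and capacity

The space `H^{⊗n}`, with `H` of dimension `d` and a fixed orthonormal basis labelled by `ZMod d`,
is `EuclideanSpace ℂ (Fin n → ZMod d)`; operators on it are matrices. -/

/-- Complete positivity: all ampliations `id_k ⊗ Φ` preserve positive semidefiniteness. -/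
def IsCompletelyPositive {α : Type} [Fintype α]
    (Φ : Matrix α α ℂ →ₗ[ℂ] Matrix α α ℂ) : Prop :=
  ∀ (k : ℕ) (B : Matrix (Fin k × α) (Fin k × α) ℂ), B.PosSemidef →
    (Matrix.of fun s t : Fin k × α =>
      Φ (Matrix.of fun a b => B (s.1, a) (t.1, b)) s.2 t.2).PosSemidef

/-- Trace-preserving completely positive linear maps. -/
def IsTPCP {α : Type} [Fintype α] (Φ : Matrix α α ℂ →ₗ[ℂ] Matrix α α ℂ) : Prop :=
  IsCompletelyPositive Φ ∧ ∀ ρ, (Φ ρ).trace = ρ.trace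

/-- The map `ρ ↦ ∑ i, M i * ρ * (M i)ᴴ` with operator-sum representation `{M i}`. -/
def operatorSum {α ι : Type} [Fintype α] [Fintype ι] (M : ι → Matrix α α ℂ) :
    Matrix α α ℂ →ₗ[ℂ] Matrix α α ℂ where
  toFun ρ := ∑ i, M i * ρ * (M i)ᴴ
  map_add' ρ σ := by simp [Matrix.mul_add, Matrix.add_mul, Finset.sum_add_distrib]
  map_smul' c ρ := by simp [Finset.smul_sum]

/-- `⟨ψ| Φ(|ψ⟩⟨ψ|) |ψ⟩`. -/
def pureFidelity {α : Type} [Fintype α] (Φ : Matrix α α ℂ →ₗ[ℂ] Matrix α α ℂ)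
    (ψ : EuclideanSpace ℂ α) : ℝ :=
  (star ψ.ofLp ⬝ᵥ (Φ (vecMulVec ψ.ofLp (star ψ.ofLp)) *ᵥ ψ.ofLp)).re

/-- Minimum fidelity over the unit vectors of the subspace `C`. -/
def minFidelity {α : Type} [Fintype α] (C : Submodule ℂ (EuclideanSpace ℂ α))
    (Φ : Matrix α α ℂ →ₗ[ℂ] Matrix α α ℂ) : ℝ :=
  sInf {f | ∃ ψ ∈ C, ‖ψ‖ = 1 ∧ f = pureFidelity Φ ψ}

/-- Linear maps on the operators on `H^{⊗n}`. -/
abbrev OpMap (d n : ℕ) : Type :=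
  Matrix (Fin n → ZMod d) (Fin n → ZMod d) ℂ →ₗ[ℂ] Matrix (Fin n → ZMod d) (Fin n → ZMod d) ℂ

/-- The supremum of the minimum fidelities of the codes `(C, ℛ)` of length `n`, used on the
channel `A`, with `log_d dim C ≥ k`. -/
def optFidelity (d : ℕ) [NeZero d] (n : ℕ) (k : ℝ) (A : OpMap d n) : ℝ :=
  sSup {f | ∃ (C : Submodule ℂ (EuclideanSpace ℂ (Fin n → ZMod d))) (ℛ : OpMap d n),
    C ≠ ⊥ ∧ k ≤ Real.logb d (Module.finrank ℂ C) ∧ IsTPCP ℛ ∧ f = minFidelity C (ℛ ∘ₗ A)}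

/-- A rate `R ≥ 0` is achievable if codes with `log_d dim C_n ≥ R n` exist, for all large `n`,
with minimum fidelity tending to one. -/
def IsAchievable (d : ℕ) [NeZero d] (𝒜 : ∀ n : ℕ, OpMap d n) (R : ℝ) : Prop :=
  0 ≤ R ∧ Tendsto (fun n : ℕ => optFidelity d n (R * n) (𝒜 n)) atTop (𝓝 1)

/-- Quantum capacity (in base `d` units): the supremum of the achievable rates. -/
def quantumCapacity (d : ℕ) [NeZero d] (𝒜 : ∀ n : ℕ, OpMap d n) : EReal :=
  ⨆ (R : ℝ) (_ : IsAchievable d 𝒜 R), (R : EReal)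

/-! ### The channel with Markov errors -/

/-- The set `{0, …, d-1}²` of labels of the single-system error operators. -/
abbrev Lbl (d : ℕ) : Type := ZMod d × ZMod d

/-- `X |j⟩ = |j - 1⟩`. -/
def weylX (d : ℕ) : Matrix (ZMod d) (ZMod d) ℂ :=
  Matrix.of fun a b => if a = b - 1 then 1 else 0

/-- `Z |j⟩ = ω ^ j |j⟩`. -/
def weylZ (d : ℕ) (ω : ℂ) : Matrix (ZMod d) (ZMod d) ℂ :=
  Matrix.diagonal fun j => ω ^ j.val

/-- `N_{(i,j)} = X ^ i * Z ^ j`. -/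
def weylN (d : ℕ) [NeZero d] (ω : ℂ) (x : Lbl d) : Matrix (ZMod d) (ZMod d) ℂ :=
  weylX d ^ x.1.val * weylZ d ω ^ x.2.val

/-- `N_x = N_{x_1} ⊗ ⋯ ⊗ N_{x_n}`. -/
def weylTensor (d : ℕ) [NeZero d] (ω : ℂ) (n : ℕ) (x : Fin n → Lbl d) :
    Matrix (Fin n → ZMod d) (Fin n → ZMod d) ℂ :=
  Matrix.of fun a b => ∏ i, weylN d ω (x i) (a i) (b i)

/-- `P_n(x_1,…,x_n) = p(x_1) ∏_j P(x_{j+1} | x_j)`, where `P u v` stands for `P(v|u)`. -/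
def markovDist {α : Type} (p : α → ℝ) (P : Matrix α α ℝ) : (n : ℕ) → (Fin n → α) → ℝ
  | 0, _ => 1
  | n + 1, x => p (x 0) * ∏ j : Fin n, P (x j.castSucc) (x j.succ)

/-- The channel `A_n ∼ {√P_n(x) N_x}`. -/
def markovChannel (d : ℕ) [NeZero d] (ω : ℂ) (p : Lbl d → ℝ) (P : Matrix (Lbl d) (Lbl d) ℝ)
    (n : ℕ) : OpMap d n :=
  operatorSum fun x : Fin n → Lbl d => ((√(markovDist p P n x) : ℝ) : ℂ) • weylTensor d ω n x

/-! ### Stationary distributions and information quantities -/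

/-- `q` is a stationary probability distribution of the transition matrix `P`. -/
def IsStationary {α : Type} [Fintype α] (P : Matrix α α ℝ) (q : α → ℝ) : Prop :=
  q ∈ stdSimplex ℝ α ∧ q ᵥ* P = q

/-- First marginal. -/
def marg₁ {α : Type} [Fintype α] (Q : α × α → ℝ) (u : α) : ℝ := ∑ v, Q (u, v)

/-- Second marginal. -/
def marg₂ {α : Type} [Fintype α] (Q : α × α → ℝ) (u : α) : ℝ := ∑ v, Q (v, u)

/-- Conditional probabilities `Q(u,v) / Q̄(u)` (used only where `Q̄(u) > 0`). -/
def condProb {α : Type} [Fintype α] (Q : α × α → ℝ) : Matrix α α ℝ :=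
  Matrix.of fun u v => Q (u, v) / marg₁ Q u

open Classical in
/-- Conditional Kullback–Leibler information `D(Q‖P)` to base `d`. It is `⊤` exactly if some term
has `Q(u,v) > 0 = P(v|u)`; terms with `Q(u,v) = 0` vanish. -/
def condKL {α : Type} [Fintype α] (d : ℕ) (Q : α × α → ℝ) (P : Matrix α α ℝ) : EReal :=
  if ∃ u v, 0 < Q (u, v) ∧ P u v = 0 then ⊤
  else ((∑ u with 0 < marg₁ Q u, ∑ v, Q (u, v) * Real.logb d (condProb Q u v / P u v) : ℝ) : EReal)

open Classical in
/-- Conditional entropy `H(P|p)` to base `d` (with `0 log 0 = 0`). -/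
def condEntropy {α : Type} [Fintype α] (d : ℕ) (P : Matrix α α ℝ) (p : α → ℝ) : ℝ :=
  -∑ u with 0 < p u, ∑ v, p u * P u v * Real.logb d (P u v)

/-- `E(R,P)`: the minimum of `D(Q‖P) + |1 - H(Q(·|·)|Q̄) - R|⁺` over the probability distributions
`Q` on pairs with equal marginals. -/
def errorExponent {α : Type} [Fintype α] (d : ℕ) (R : ℝ) (P : Matrix α α ℝ) : EReal :=
  ⨅ (Q : α × α → ℝ) (_ : Q ∈ stdSimplex ℝ (α × α) ∧ marg₁ Q = marg₂ Q),
    condKL d Q P + ((max (1 - condEntropy d (condProb Q) (marg₁ Q) - R) 0 : ℝ) : EReal)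

end MarkovChannel

end

/-! Stationarity. By the maximum principle, harmonic functions of an irreducible chain are constant,
so `1 - P` has a one-dimensional kernel and its range is the whole hyperplane of functions with
`q`-mean zero. This solvability of the Poisson equation (`exists_poisson`) gives uniqueness of `q`,
and a law of large numbers that needs no aperiodicity.

Exponent. The inequality `log t ≤ t - 1`, strict for `t ≠ 1`, gives `D ≥ 0` and shows that `D = 0`
forces `Q = Q̄ P`; equal marginals then make `Q̄` stationary, hence equal to `q`. On the compact set
of admissible `Q` supported where `P` is positive, the objective defining `E(R,P)` is continuous. It
is positive pointwise: where `D` vanishes, the other summand is at least `1 - H(P|q) - R > 0`. So it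
has a positive minimum, while `D = ⊤` off this set.

Capacity. For `H(P|q) < h < 1 - R`, about `d ^ (n h)` typical error paths carry almost all the
probability (`tendsto_sum_typicalSet`). Weyl errors commute up to the character of a symplectic
form, so errors whose difference has nonzero syndrome send a joint eigenspace of commuting Weyl
operators to orthogonal subspaces, and such errors can be corrected together (`exists_recovery`). A
family of `m`-generator stabilizers, built from multiplication in the field with `d ^ n` elements,
gives each nonzero error syndrome zero with probability exactly `d ^ (-m)`. Averaging over the
family finds a code that confuses typical errors of weight at most `|T| / d ^ m`
(`exists_sum_confused_le`). With `m ≈ n (1 - R)` this loss decays exponentially, and the code has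
dimension at least `d ^ (n - m)`. -/

namespace MarkovChannel

/-! ### Stationary distributions and the Poisson equation. -/

section Stationary

variable {α : Type} [Fintype α] [DecidableEq α] {P : Matrix α α ℝ}

/-- Maximum principle: harmonic functions of an irreducible chain are constant. -/
theorem eq_of_mulVec_eq_self (hP : P ∈ rowStochastic ℝ α) (hirr : P.IsIrreducible)
    {h : α → ℝ} (hh : P *ᵥ h = h) (i j : α) : h i = h j := by
  have : Nonempty α := ⟨i⟩
  obtain ⟨m, hm⟩ := Finite.exists_max h
  have hpow : ∀ k : ℕ, (P ^ k) *ᵥ h = h := by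
    intro k
    induction k with
    | zero => simp
    | succ k ih => rw [pow_succ, ← mulVec_mulVec, hh, ih]
  have key : ∀ j, h j = h m := by
    intro j
    obtain ⟨k, -, hk⟩ := (isIrreducible_iff_exists_pow_pos hirr.nonneg).1 hirr m j
    have hPk : P ^ k ∈ rowStochastic ℝ α := pow_mem hP k
    have h1 : ∑ l, (P ^ k) m l * (h m - h l) = 0 := by
      have h2 : ∑ l, (P ^ k) m l * h l = h m := congrFun (hpow k) m
      simp only [mul_sub, Finset.sum_sub_distrib, h2, ← Finset.sum_mul,
        sum_row_of_mem_rowStochastic hPk, one_mul, sub_self]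
    have h3 := (Finset.sum_eq_zero_iff_of_nonneg (fun l _ => mul_nonneg
      (nonneg_of_mem_rowStochastic hPk) (sub_nonneg.2 (hm l)))).1 h1 j (Finset.mem_univ j)
    rcases mul_eq_zero.1 h3 with h4 | h4
    · exact absurd h4 hk.ne'
    · linarith
  rw [key i, key j]

/-- A row-stochastic matrix has a stationary distribution. -/
theorem exists_isStationary [Nonempty α] (hP : P ∈ rowStochastic ℝ α) :
    ∃ q, IsStationary P q := by
  -- The constant function is a right null vector of `P - 1`, so a left null vector exists as well;
  -- its signs are still unknown.
  have hdet : (P - 1).det = 0 := by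
    refine exists_mulVec_eq_zero_iff.1 ⟨1, one_ne_zero, ?_⟩
    rw [sub_mulVec, one_vecMul_of_mem_rowStochastic hP, one_mulVec, sub_self]
  obtain ⟨v, hv0, hv⟩ := exists_vecMul_eq_zero_iff.2 hdet
  have hvP : v ᵥ* P = v := by
    rw [vecMul_sub, vecMul_one] at hv
    exact sub_eq_zero.1 hv
  have hle : ∀ j, |v j| ≤ ∑ i, |v i| * P i j := by
    intro j
    calc |v j| = |∑ i, v i * P i j| := by rw [← congrFun hvP j]; rfl
      _ ≤ ∑ i, |v i * P i j| := Finset.abs_sum_le_sum_abs _ _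
      _ = ∑ i, |v i| * P i j := by
        simp only [abs_mul, abs_of_nonneg (nonneg_of_mem_rowStochastic hP)]
  have hsum : ∑ j, |v j| = ∑ j, ∑ i, |v i| * P i j := by
    rw [Finset.sum_comm]
    simp only [← Finset.mul_sum, sum_row_of_mem_rowStochastic hP, mul_one]
  -- The entrywise inequalities `|v| ≤ |v| P` have equal total sums, so each is an equality and
  -- `|v|` is itself invariant.
  have heq := (Finset.sum_eq_sum_iff_of_le (fun j _ => hle j)).1 hsum
  have hpos : 0 < ∑ j, |v j| := by
    obtain ⟨i, hi⟩ := Function.ne_iff.1 hv0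
    exact Finset.sum_pos' (fun _ _ => abs_nonneg _) ⟨i, Finset.mem_univ i, abs_pos.2 hi⟩
  refine ⟨fun j => |v j| / ∑ i, |v i|, ⟨fun j => by positivity, ?_⟩, ?_⟩
  · rw [← Finset.sum_div, div_self hpos.ne']
  · ext j
    simp only [vecMul, dotProduct, div_mul_eq_mul_div, ← Finset.sum_div]
    rw [heq j (Finset.mem_univ j)]

/-- Solvability of the Poisson equation. -/
theorem exists_poisson (hP : P ∈ rowStochastic ℝ α) (hirr : P.IsIrreducible)
    {q : α → ℝ} (hq : IsStationary P q) (f : α → ℝ) (hf : q ⬝ᵥ f = 0) :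
    ∃ g : α → ℝ, g - P *ᵥ g = f := by
  let L : (α → ℝ) →ₗ[ℝ] (α → ℝ) := LinearMap.id - P.mulVecLin
  let φ : (α → ℝ) →ₗ[ℝ] ℝ := dotProductBilin ℝ ℝ q
  have hφ : ∀ f, φ f = q ⬝ᵥ f := fun _ => rfl
  have hq1 : q ⬝ᵥ 1 = 1 := by rw [dotProduct_one]; exact hq.1.2
  have hker : Module.finrank ℝ (LinearMap.ker L) ≤ 1 := by
    rw [finrank_le_one_iff]
    refine ⟨⟨1, ?_⟩, ?_⟩
    · simp [L, one_vecMul_of_mem_rowStochastic hP]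
    · rintro ⟨h, hh⟩
      have hh' : P *ᵥ h = h := by
        simp only [L, LinearMap.mem_ker, LinearMap.sub_apply, LinearMap.id_apply,
          mulVecLin_apply] at hh
        exact (sub_eq_zero.1 hh).symm
      rcases isEmpty_or_nonempty α with hα | ⟨⟨i⟩⟩
      · exact ⟨0, Subsingleton.elim _ _⟩
      · refine ⟨h i, Subtype.ext (funext fun j => ?_)⟩
        simpa using eq_of_mulVec_eq_self hP hirr hh' i j
  have hle : LinearMap.range L ≤ LinearMap.ker φ := by
    rintro _ ⟨g, rfl⟩
    rw [LinearMap.mem_ker, hφ]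
    simp only [L, LinearMap.sub_apply, LinearMap.id_apply, mulVecLin_apply, dotProduct_sub,
      dotProduct_mulVec, hq.2, sub_self]
  have hφr : 1 ≤ Module.finrank ℝ (LinearMap.range φ) := by
    have : LinearMap.range φ = ⊤ := by
      refine LinearMap.range_eq_top.2 (fun c => ⟨c • 1, ?_⟩)
      rw [map_smul, hφ, hq1, smul_eq_mul, mul_one]
    rw [this, finrank_top, Module.finrank_self]
  have h1 := L.finrank_range_add_finrank_ker
  have h2 := φ.finrank_range_add_finrank_ker
  -- The range of `1 - P` lies in the hyperplane `ker φ` and has codimension at most one, so the two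
  -- coincide.
  have heq := Submodule.eq_of_le_of_finrank_le hle (by omega)
  have hmem : f ∈ LinearMap.range L := by
    rw [heq, LinearMap.mem_ker, hφ, hf]
  obtain ⟨g, hg⟩ := hmem
  exact ⟨g, hg⟩

/-- Any stationary `r` annihilates the range of `1 - P`, which contains `f - (q ⬝ᵥ f) • 1`; hence
`r` and `q` integrate every `f` alike. -/
theorem IsStationary.eq (hP : P ∈ rowStochastic ℝ α) (hirr : P.IsIrreducible)
    {q r : α → ℝ} (hq : IsStationary P q) (hr : IsStationary P r) : r = q := by
  have key : ∀ f, r ⬝ᵥ f = q ⬝ᵥ f := by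
    intro f
    have hq1 : q ⬝ᵥ 1 = 1 := by rw [dotProduct_one]; exact hq.1.2
    have hr1 : r ⬝ᵥ 1 = 1 := by rw [dotProduct_one]; exact hr.1.2
    obtain ⟨g, hg⟩ := exists_poisson hP hirr hq (f - (q ⬝ᵥ f) • 1) (by
      rw [dotProduct_sub, dotProduct_smul, hq1]; simp)
    have h := congrArg (r ⬝ᵥ ·) hg
    simp only [dotProduct_sub, dotProduct_mulVec, hr.2, sub_self, dotProduct_smul, hr1] at h
    simp only [smul_eq_mul, mul_one] at h
    linarith
  ext i
  simpa using key (Pi.single i 1)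

theorem existsUnique_isStationary [Nonempty α] (hP : P ∈ rowStochastic ℝ α)
    (hirr : P.IsIrreducible) : ∃! q, IsStationary P q := by
  obtain ⟨q, hq⟩ := exists_isStationary hP
  exact ⟨q, hq, fun r hr => hq.eq hP hirr hr⟩

end Stationary

/-! ### Kullback–Leibler information, conditional entropy and the exponent. -/

section Information

variable {α : Type} [Fintype α] {P : Matrix α α ℝ} {Q : α × α → ℝ}

/-- This is `log t ≤ t - 1` at `t = b / a`. The condition `hab` excludes `a > 0 = b`, where the
default values make the right side zero. -/
theorem sub_le_mul_log_div {a b : ℝ} (ha : 0 ≤ a) (hb : 0 ≤ b) (hab : b = 0 → a = 0) :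
    a - b ≤ a * Real.log (a / b) := by
  rcases ha.eq_or_lt with rfl | ha
  · simpa using hb
  · have hb' : 0 < b := hb.lt_of_ne fun h => ha.ne' (hab h.symm)
    have h := Real.log_le_sub_one_of_pos (div_pos hb' ha)
    rw [← inv_div, Real.log_inv]
    have h2 : a * Real.log (b / a) ≤ a * (b / a - 1) := mul_le_mul_of_nonneg_left h ha.le
    have h3 : a * (b / a - 1) = b - a := by field_simp
    linarith

theorem eq_of_mul_log_div_eq_sub {a b : ℝ} (ha : 0 ≤ a) (hb : 0 ≤ b) (hab : b = 0 → a = 0)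
    (h : a - b = a * Real.log (a / b)) : a = b := by
  rcases ha.eq_or_lt with rfl | ha
  · simpa [eq_comm] using h
  · have hb' : 0 < b := hb.lt_of_ne fun h => ha.ne' (hab h.symm)
    by_contra hne
    have h1 := Real.log_lt_sub_one_of_pos (div_pos hb' ha)
      (fun h => hne ((div_eq_one_iff_eq ha.ne').1 h).symm)
    rw [← inv_div, Real.log_inv] at h
    have h2 : a * Real.log (b / a) < a * (b / a - 1) := mul_lt_mul_of_pos_left h1 ha
    have h3 : a * (b / a - 1) = b - a := by field_simp
    linarith

theorem marg₁_nonneg (hQ : ∀ x, 0 ≤ Q x) (u : α) : 0 ≤ marg₁ Q u :=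
  Finset.sum_nonneg fun _ _ => hQ _

theorem eq_zero_of_marg₁_eq_zero (hQ : ∀ x, 0 ≤ Q x) {u : α} (hu : marg₁ Q u = 0) (v : α) :
    Q (u, v) = 0 :=
  (Finset.sum_eq_zero_iff_of_nonneg fun v _ => hQ (u, v)).1 hu v (Finset.mem_univ v)

theorem sum_marg₁ (hQ : Q ∈ stdSimplex ℝ (α × α)) : ∑ u, marg₁ Q u = 1 := by
  rw [← hQ.2, Fintype.sum_prod_type]
  rfl

/-- `D(Q‖P)` in natural units, for `Q` absolutely continuous with respect to `P`. -/
noncomputable def klNat (Q : α × α → ℝ) (P : Matrix α α ℝ) : ℝ :=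
  ∑ u, ∑ v, Q (u, v) * Real.log (Q (u, v) / (marg₁ Q u * P u v))

theorem condKL_eq_top (d : ℕ) (h : ∃ u v, 0 < Q (u, v) ∧ P u v = 0) : condKL d Q P = ⊤ := by
  rw [condKL, if_pos h]

theorem condKL_eq_klNat (d : ℕ) (hQ : ∀ x, 0 ≤ Q x) (h : ∀ u v, P u v = 0 → Q (u, v) = 0) :
    condKL d Q P = ((klNat Q P / Real.log d : ℝ) : EReal) := by
  classical
  rw [condKL, if_neg (by rintro ⟨u, v, h1, h2⟩; exact h1.ne' (h u v h2))]
  congr 1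
  rw [klNat, Finset.sum_div, Finset.sum_filter]
  refine Finset.sum_congr rfl fun u _ => ?_
  split_ifs with hu
  · rw [Finset.sum_div]
    refine Finset.sum_congr rfl fun v _ => ?_
    rw [Real.logb, condProb, of_apply, div_div, mul_div_assoc]
  · have hu0 : marg₁ Q u = 0 := le_antisymm (not_lt.1 hu) (marg₁_nonneg hQ u)
    simp [eq_zero_of_marg₁_eq_zero hQ hu0]

theorem sum_marg₁_mul [DecidableEq α] (hP : P ∈ rowStochastic ℝ α) (Q : α × α → ℝ) :
    ∑ u, ∑ v, (Q (u, v) - marg₁ Q u * P u v) = 0 := by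
  simp only [Finset.sum_sub_distrib, ← Finset.mul_sum, sum_row_of_mem_rowStochastic hP, mul_one]
  exact sub_self _

theorem marg₁_mul_eq_zero (hQ : ∀ x, 0 ≤ Q x) (h : ∀ u v, P u v = 0 → Q (u, v) = 0) (u v : α)
    (huv : marg₁ Q u * P u v = 0) : Q (u, v) = 0 := by
  rcases mul_eq_zero.1 huv with h1 | h1
  · exact eq_zero_of_marg₁_eq_zero hQ h1 v
  · exact h u v h1

theorem klNat_nonneg [DecidableEq α] (hP : P ∈ rowStochastic ℝ α)
    (hQ : Q ∈ stdSimplex ℝ (α × α)) (h : ∀ u v, P u v = 0 → Q (u, v) = 0) : 0 ≤ klNat Q P := by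
  rw [← sum_marg₁_mul hP Q]
  exact Finset.sum_le_sum fun u _ => Finset.sum_le_sum fun v _ =>
    sub_le_mul_log_div (hQ.1 _)
      (mul_nonneg (marg₁_nonneg hQ.1 u) (nonneg_of_mem_rowStochastic hP))
      (marg₁_mul_eq_zero hQ.1 h u v)

theorem eq_marg₁_mul_of_klNat_eq_zero [DecidableEq α] (hP : P ∈ rowStochastic ℝ α)
    (hQ : Q ∈ stdSimplex ℝ (α × α)) (h : ∀ u v, P u v = 0 → Q (u, v) = 0)
    (h0 : klNat Q P = 0) (u v : α) : Q (u, v) = marg₁ Q u * P u v := by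
  have hnn : ∀ u v, 0 ≤ marg₁ Q u * P u v := fun u v =>
    mul_nonneg (marg₁_nonneg hQ.1 u) (nonneg_of_mem_rowStochastic hP)
  have hle : ∀ u v, Q (u, v) - marg₁ Q u * P u v ≤
      Q (u, v) * Real.log (Q (u, v) / (marg₁ Q u * P u v)) := fun u v =>
    sub_le_mul_log_div (hQ.1 _) (hnn u v) (marg₁_mul_eq_zero hQ.1 h u v)
  have h1 := (sum_marg₁_mul hP Q).trans h0.symm
  have h2 := (Finset.sum_eq_sum_iff_of_le
    (fun u _ => Finset.sum_le_sum fun v _ => hle u v)).1 h1 u (Finset.mem_univ u)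
  have h3 := (Finset.sum_eq_sum_iff_of_le (fun v _ => hle u v)).1 h2 v (Finset.mem_univ v)
  exact eq_of_mul_log_div_eq_sub (hQ.1 _) (hnn u v) (marg₁_mul_eq_zero hQ.1 h u v) h3

theorem marg₁_of_eq_mul [DecidableEq α] (hP : P ∈ rowStochastic ℝ α) {q : α → ℝ}
    (h : ∀ u v, Q (u, v) = q u * P u v) : marg₁ Q = q := by
  ext u
  simp only [marg₁, h, ← Finset.mul_sum, sum_row_of_mem_rowStochastic hP, mul_one]

theorem klNat_eq_zero_iff [DecidableEq α] (hP : P ∈ rowStochastic ℝ α) (hirr : P.IsIrreducible)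
    {q : α → ℝ} (hq : IsStationary P q) (hQ : Q ∈ stdSimplex ℝ (α × α))
    (hm : marg₁ Q = marg₂ Q) (h : ∀ u v, P u v = 0 → Q (u, v) = 0) :
    klNat Q P = 0 ↔ ∀ u v, Q (u, v) = q u * P u v := by
  constructor
  · intro h0
    have h1 := eq_marg₁_mul_of_klNat_eq_zero hP hQ h h0
    have hst : IsStationary P (marg₁ Q) := by
      refine ⟨⟨marg₁_nonneg hQ.1, sum_marg₁ hQ⟩, ?_⟩
      ext v
      conv_rhs => rw [hm]
      simp only [vecMul, dotProduct, marg₂]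
      exact Finset.sum_congr rfl fun u _ => (h1 u v).symm
    intro u v
    rw [h1 u v, hq.eq hP hirr hst]
  · intro h0
    have h1 := marg₁_of_eq_mul hP h0
    refine Finset.sum_eq_zero fun u _ => Finset.sum_eq_zero fun v _ => ?_
    rw [h1, ← h0 u v]
    rcases eq_or_ne (Q (u, v)) 0 with h2 | h2
    · simp [h2]
    · simp [div_self h2]

theorem condKL_nonneg_and_eq_zero_iff [DecidableEq α] {d : ℕ} (hd : 1 < d)
    (hP : P ∈ rowStochastic ℝ α) (hirr : P.IsIrreducible)
    {q : α → ℝ} (hq : IsStationary P q) (hQ : Q ∈ stdSimplex ℝ (α × α))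
    (hm : marg₁ Q = marg₂ Q) :
    0 ≤ condKL d Q P ∧ (condKL d Q P = 0 ↔ ∀ u v, Q (u, v) = q u * P u v) := by
  have hlog : 0 < Real.log d := Real.log_pos (by exact_mod_cast hd)
  by_cases hac : ∀ u v, P u v = 0 → Q (u, v) = 0
  · rw [condKL_eq_klNat d hQ.1 hac]
    constructor
    · exact_mod_cast div_nonneg (klNat_nonneg hP hQ hac) hlog.le
    · rw [← klNat_eq_zero_iff hP hirr hq hQ hm hac, EReal.coe_eq_zero, div_eq_zero_iff]
      simp [hlog.ne']
  · push Not at hac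
    obtain ⟨u, v, h1, h2⟩ := hac
    rw [condKL_eq_top d ⟨u, v, (hQ.1 _).lt_of_ne' h2, h1⟩]
    refine ⟨le_top, fun h => absurd h EReal.top_ne_zero, fun h => absurd ?_ h2⟩
    rw [h u v, h1, mul_zero]

/-- Splitting the logarithm removes the quotients: the right side is visibly continuous in `Q`, as
the compactness argument requires. -/
theorem klNat_eq_negMulLog (hQ : ∀ x, 0 ≤ Q x) (h : ∀ u v, P u v = 0 → Q (u, v) = 0) :
    klNat Q P = ∑ u, Real.negMulLog (marg₁ Q u) - ∑ u, ∑ v, Real.negMulLog (Q (u, v))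
      - ∑ u, ∑ v, Q (u, v) * Real.log (P u v) := by
  rw [klNat, ← Finset.sum_sub_distrib, ← Finset.sum_sub_distrib]
  refine Finset.sum_congr rfl fun u _ => ?_
  have h1 : Real.negMulLog (marg₁ Q u) = ∑ v, -(Q (u, v) * Real.log (marg₁ Q u)) := by
    rw [Finset.sum_neg_distrib, ← Finset.sum_mul, Real.negMulLog, neg_mul]
    rfl
  rw [h1, ← Finset.sum_sub_distrib, ← Finset.sum_sub_distrib]
  refine Finset.sum_congr rfl fun v _ => ?_
  rcases eq_or_ne (Q (u, v)) 0 with h2 | h2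
  · simp [h2]
  · have h3 : P u v ≠ 0 := fun h3 => h2 (h u v h3)
    have h4 : marg₁ Q u ≠ 0 := fun h4 => h2 (eq_zero_of_marg₁_eq_zero hQ h4 v)
    rw [Real.log_div h2 (mul_ne_zero h4 h3), Real.log_mul h4 h3, Real.negMulLog]
    ring

theorem condEntropy_condProb (d : ℕ) (hQ : ∀ x, 0 ≤ Q x) :
    condEntropy d (condProb Q) (marg₁ Q) =
      (∑ u, ∑ v, Real.negMulLog (Q (u, v)) - ∑ u, Real.negMulLog (marg₁ Q u)) / Real.log d := by
  classical
  rw [condEntropy, Finset.sum_filter, ← Finset.sum_neg_distrib, ← Finset.sum_sub_distrib,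
    Finset.sum_div]
  refine Finset.sum_congr rfl fun u _ => ?_
  split_ifs with hu
  · have h1 : Real.negMulLog (marg₁ Q u) = ∑ v, -(Q (u, v) * Real.log (marg₁ Q u)) := by
      rw [Finset.sum_neg_distrib, ← Finset.sum_mul, Real.negMulLog, neg_mul]
      rfl
    rw [h1, ← Finset.sum_sub_distrib, ← Finset.sum_neg_distrib, Finset.sum_div]
    refine Finset.sum_congr rfl fun v _ => ?_
    rw [condProb, of_apply, mul_div_cancel₀ _ hu.ne', Real.logb]
    rcases eq_or_ne (Q (u, v)) 0 with h2 | h2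
    · simp [h2]
    · rw [Real.log_div h2 hu.ne', Real.negMulLog]
      ring
  · have hu0 : marg₁ Q u = 0 := le_antisymm (not_lt.1 hu) (marg₁_nonneg hQ u)
    simp [eq_zero_of_marg₁_eq_zero hQ hu0, hu0]

theorem continuous_marg₁ (u : α) : Continuous fun Q : α × α → ℝ => marg₁ Q u := by
  unfold marg₁
  fun_prop

theorem continuous_marg₂ (u : α) : Continuous fun Q : α × α → ℝ => marg₂ Q u := by
  unfold marg₂
  fun_prop

theorem condEntropy_congr (d : ℕ) {P' : Matrix α α ℝ} {q : α → ℝ}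
    (h : ∀ u v, 0 < q u → P u v = P' u v) : condEntropy d P q = condEntropy d P' q := by
  classical
  rw [condEntropy, condEntropy]
  congr 1
  refine Finset.sum_congr rfl fun u hu => Finset.sum_congr rfl fun v _ => ?_
  rw [h u v (Finset.mem_filter.1 hu).2]

theorem errorExponent_pos [DecidableEq α] {d : ℕ} (hd : 1 < d)
    (hP : P ∈ rowStochastic ℝ α) (hirr : P.IsIrreducible)
    {q : α → ℝ} (hq : IsStationary P q) {R : ℝ} (hR : R < 1 - condEntropy d P q) :
    0 < errorExponent d R P := by
  have hlog : 0 < Real.log d := Real.log_pos (by exact_mod_cast hd)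
  let K : Set (α × α → ℝ) := {Q | Q ∈ stdSimplex ℝ (α × α) ∧ (∀ u, marg₁ Q u = marg₂ Q u) ∧
    ∀ u v, P u v = 0 → Q (u, v) = 0}
  have hK : IsCompact K := by
    have h1 : IsClosed {Q : α × α → ℝ | ∀ u, marg₁ Q u = marg₂ Q u} := by
      simp only [Set.ofPred_forall]
      exact isClosed_iInter fun u => isClosed_eq (continuous_marg₁ u) (continuous_marg₂ u)
    have h2 : IsClosed {Q : α × α → ℝ | ∀ u v, P u v = 0 → Q (u, v) = 0} := by
      simp only [Set.ofPred_forall]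
      exact isClosed_iInter fun u => isClosed_iInter fun v => isClosed_iInter fun _ =>
        isClosed_eq (continuous_apply _) continuous_const
    exact (isCompact_stdSimplex ℝ (α × α)).inter_right (h1.inter h2)
  let S : (α × α → ℝ) → ℝ := fun Q =>
    ∑ u, ∑ v, Real.negMulLog (Q (u, v)) - ∑ u, Real.negMulLog (marg₁ Q u)
  -- A function continuous on the whole space that agrees with the objective of `errorExponent` on
  -- `K`.
  let F : (α × α → ℝ) → ℝ := fun Q =>
    (-S Q - ∑ u, ∑ v, Q (u, v) * Real.log (P u v)) / Real.log d
      + max (1 - S Q / Real.log d - R) 0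
  have hS : Continuous S := by
    refine Continuous.sub ?_ ?_
    · exact continuous_finsetSum _ fun u _ => continuous_finsetSum _ fun v _ =>
        Real.continuous_negMulLog.comp (continuous_apply _)
    · exact continuous_finsetSum _ fun u _ => Real.continuous_negMulLog.comp (continuous_marg₁ u)
  have hF : Continuous F := by fun_prop
  have hFK : ∀ Q ∈ K, F Q = klNat Q P / Real.log d
      + max (1 - condEntropy d (condProb Q) (marg₁ Q) - R) 0 := by
    intro Q hQ
    rw [condEntropy_condProb d hQ.1.1, klNat_eq_negMulLog hQ.1.1 hQ.2.2]
    simp only [F, S]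
    ring
  have hpos : ∀ Q ∈ K, 0 < F Q := by
    intro Q hQ
    rw [hFK Q hQ]
    rcases (klNat_nonneg hP hQ.1 hQ.2.2).eq_or_lt with h0 | h0
    · have hQq := (klNat_eq_zero_iff hP hirr hq hQ.1 (funext hQ.2.1) hQ.2.2).1 h0.symm
      have hm := marg₁_of_eq_mul hP hQq
      have : condEntropy d (condProb Q) (marg₁ Q) = condEntropy d P q := by
        rw [hm]
        refine condEntropy_congr d fun u v hu => ?_
        rw [condProb, of_apply, hQq, hm, mul_div_cancel_left₀ _ hu.ne']
      rw [← h0, this, zero_div, zero_add]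
      exact lt_max_of_lt_left (by linarith)
    · exact add_pos_of_pos_of_nonneg (div_pos h0 hlog) (le_max_right _ _)
  obtain ⟨c, hc, hcF⟩ : ∃ c : ℝ, 0 < c ∧ ∀ Q ∈ K, c ≤ F Q := by
    rcases K.eq_empty_or_nonempty with hE | hE
    · exact ⟨1, one_pos, by simp [hE]⟩
    · obtain ⟨Q₀, hQ₀, hmin⟩ := hK.exists_isMinOn hE hF.continuousOn
      exact ⟨F Q₀, hpos Q₀ hQ₀, fun Q hQ => hmin hQ⟩
  refine lt_of_lt_of_le (b := (c : EReal)) (by exact_mod_cast hc) ?_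
  refine le_iInf fun Q => le_iInf fun hQ => ?_
  by_cases hac : ∀ u v, P u v = 0 → Q (u, v) = 0
  · have hQK : Q ∈ K := ⟨hQ.1, fun u => congrFun hQ.2 u, hac⟩
    rw [condKL_eq_klNat d hQ.1.1 hac, ← EReal.coe_add, ← hFK Q hQK]
    exact_mod_cast hcF Q hQK
  · push Not at hac
    obtain ⟨u, v, h1, h2⟩ := hac
    rw [condKL_eq_top d ⟨u, v, (hQ.1.1 _).lt_of_ne' h2, h1⟩, EReal.top_add_coe]
    exact le_top

end Information

/-! ### Markov paths and asymptotic equipartition. -/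

section Equipartition

variable {α : Type} {P : Matrix α α ℝ} {p : α → ℝ}

theorem markovDist_snoc (p : α → ℝ) (P : Matrix α α ℝ) (n : ℕ) (x : Fin (n + 1) → α) (v : α) :
    markovDist p P (n + 2) (Fin.snoc x v : Fin (n + 2) → α) =
      markovDist p P (n + 1) x * P (x (Fin.last n)) v := by
  have h0 : (Fin.snoc x v : Fin (n + 2) → α) 0 = x 0 := Fin.snoc_castSucc (α := fun _ => α) v x 0
  have hc : ∀ j : Fin (n + 1), (Fin.snoc x v : Fin (n + 2) → α) j.castSucc = x j :=
    fun j => Fin.snoc_castSucc (α := fun _ => α) v x j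
  have hl : (Fin.snoc x v : Fin (n + 2) → α) (Fin.last (n + 1)) = v :=
    Fin.snoc_last (α := fun _ => α) v x
  simp only [markovDist]
  rw [Fin.prod_univ_castSucc, h0, hc, Fin.succ_last, hl, ← mul_assoc]
  congr 2
  refine Finset.prod_congr rfl fun j _ => ?_
  rw [hc, Fin.succ_castSucc, hc]

/-- The additive functional `∑ j, D(x_j, x_{j+1})` of a path. -/
def pathSum (D : α → α → ℝ) (n : ℕ) (x : Fin (n + 1) → α) : ℝ :=
  ∑ j : Fin n, D (x j.castSucc) (x j.succ)

theorem pathSum_snoc (D : α → α → ℝ) (n : ℕ) (x : Fin (n + 1) → α) (v : α) :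
    pathSum D (n + 1) (Fin.snoc x v : Fin (n + 2) → α) =
      pathSum D n x + D (x (Fin.last n)) v := by
  have hc : ∀ j : Fin (n + 1), (Fin.snoc x v : Fin (n + 2) → α) j.castSucc = x j :=
    fun j => Fin.snoc_castSucc (α := fun _ => α) v x j
  have hl : (Fin.snoc x v : Fin (n + 2) → α) (Fin.last (n + 1)) = v :=
    Fin.snoc_last (α := fun _ => α) v x
  rw [pathSum, pathSum, Fin.sum_univ_castSucc, hc, Fin.succ_last, hl]
  congr 1
  refine Finset.sum_congr rfl fun j _ => ?_
  rw [hc, Fin.succ_castSucc, hc]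

theorem sum_snoc [Fintype α] (n : ℕ) (F : (Fin (n + 1) → α) → ℝ) :
    ∑ x, F x = ∑ x : Fin n → α, ∑ v, F (Fin.snoc x v : Fin (n + 1) → α) := by
  rw [← (Fin.snocEquiv fun _ : Fin (n + 1) => α).sum_comp, Fintype.sum_prod_type, Finset.sum_comm]
  rfl

variable [Fintype α] [DecidableEq α]

theorem markovDist_nonneg (hP : P ∈ rowStochastic ℝ α) (hp : p ∈ stdSimplex ℝ α) (n : ℕ)
    (x : Fin n → α) : 0 ≤ markovDist p P n x := by
  cases n with
  | zero => exact zero_le_one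
  | succ n =>
    exact mul_nonneg (hp.1 _) (Finset.prod_nonneg fun _ _ => nonneg_of_mem_rowStochastic hP)

theorem sum_markovDist (hP : P ∈ rowStochastic ℝ α) (hp : p ∈ stdSimplex ℝ α) (n : ℕ) :
    ∑ x, markovDist p P n x = 1 := by
  cases n with
  | zero => simp [markovDist]
  | succ n =>
    induction n with
    | zero =>
      rw [sum_snoc]
      simpa [markovDist, Fin.snoc] using hp.2
    | succ n ih =>
      rw [sum_snoc, ← ih]
      refine Finset.sum_congr rfl fun x _ => ?_
      simp only [markovDist_snoc, ← Finset.mul_sum, sum_row_of_mem_rowStochastic hP, mul_one]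

/-- Total probability for the uniform initial law, multiplied by the number of states. -/
theorem sum_prod_transition (hP : P ∈ rowStochastic ℝ α) (n : ℕ) :
    ∑ x : Fin (n + 1) → α, ∏ j : Fin n, P (x j.castSucc) (x j.succ) = Fintype.card α := by
  rcases isEmpty_or_nonempty α with h | h
  · simp
  · have hc : (Fintype.card α : ℝ) ≠ 0 := by exact_mod_cast Fintype.card_ne_zero
    have hp : (fun _ => (Fintype.card α : ℝ)⁻¹) ∈ stdSimplex ℝ α :=
      ⟨fun _ => by positivity, by simp [hc]⟩
    have h1 := sum_markovDist hP hp (n + 1)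
    simp only [markovDist, ← Finset.mul_sum] at h1
    field_simp at h1
    exact h1

/-- Variance bound for additive functionals with centred increments. -/
theorem sum_markovDist_mul_pathSum_sq_le (hP : P ∈ rowStochastic ℝ α) (hp : p ∈ stdSimplex ℝ α)
    {D : α → α → ℝ} (hD : ∀ u, ∑ v, P u v * D u v = 0) {B : ℝ} (hB : ∀ u v, D u v ^ 2 ≤ B)
    (n : ℕ) : ∑ x, markovDist p P (n + 1) x * pathSum D n x ^ 2 ≤ n * B := by
  induction n with
  | zero => simp [pathSum]
  | succ n ih =>
    rw [sum_snoc]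
    have h1 : ∀ x : Fin (n + 1) → α, ∑ v, markovDist p P (n + 2) (Fin.snoc x v : Fin (n + 2) → α)
        * pathSum D (n + 1) (Fin.snoc x v : Fin (n + 2) → α) ^ 2 ≤
        markovDist p P (n + 1) x * pathSum D n x ^ 2 + markovDist p P (n + 1) x * B := by
      intro x
      -- Given the last state, the new increment has mean zero: the cross term vanishes and the
      -- second moment grows by at most `B`.
      have h2 : ∑ v, P (x (Fin.last n)) v * (pathSum D n x + D (x (Fin.last n)) v) ^ 2 ≤
          pathSum D n x ^ 2 + B := by
        calc _ = ∑ v, (P (x (Fin.last n)) v * pathSum D n x ^ 2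
              + 2 * pathSum D n x * (P (x (Fin.last n)) v * D (x (Fin.last n)) v)
              + P (x (Fin.last n)) v * D (x (Fin.last n)) v ^ 2) :=
            Finset.sum_congr rfl fun v _ => by ring
          _ ≤ ∑ v, (P (x (Fin.last n)) v * pathSum D n x ^ 2
              + 2 * pathSum D n x * (P (x (Fin.last n)) v * D (x (Fin.last n)) v)
              + P (x (Fin.last n)) v * B) :=
            Finset.sum_le_sum fun v _ => by
              have := mul_le_mul_of_nonneg_left (hB (x (Fin.last n)) v)
                (nonneg_of_mem_rowStochastic hP (i := x (Fin.last n)) (j := v))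
              linarith
          _ = pathSum D n x ^ 2 + B := by
            simp only [Finset.sum_add_distrib, ← Finset.sum_mul, ← Finset.mul_sum, hD,
              sum_row_of_mem_rowStochastic hP]
            ring
      simp only [markovDist_snoc, pathSum_snoc, mul_assoc, ← Finset.mul_sum]
      rw [← mul_add]
      exact mul_le_mul_of_nonneg_left h2 (markovDist_nonneg hP hp _ _)
    refine (Finset.sum_le_sum fun x _ => h1 x).trans ?_
    rw [Finset.sum_add_distrib, ← Finset.sum_mul, sum_markovDist hP hp]
    push_cast
    linarith

open Classical in
/-- Paths whose transition probabilities multiply to at least `d ^ (-n h)`. -/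
noncomputable def typicalSet (d : ℕ) (P : Matrix α α ℝ) (h : ℝ) (n : ℕ) :
    Finset (Fin (n + 1) → α) :=
  {x | (d : ℝ) ^ (-(n * h)) ≤ ∏ j : Fin n, P (x j.castSucc) (x j.succ)}

/-- Each typical path contributes at least `d ^ (-n h)` to the total `sum_prod_transition`. The
initial law plays no role. -/
theorem card_typicalSet_le (hP : P ∈ rowStochastic ℝ α) {d : ℕ} (hd : 0 < d) (h : ℝ) (n : ℕ) :
    ((typicalSet d P h n).card : ℝ) ≤ Fintype.card α * (d : ℝ) ^ (n * h) := by
  have hd' : (0 : ℝ) < d := by exact_mod_cast hd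
  have h1 : ((typicalSet d P h n).card : ℝ) * (d : ℝ) ^ (-(n * h)) ≤ Fintype.card α := by
    rw [← nsmul_eq_mul, ← sum_prod_transition hP n]
    refine (Finset.card_nsmul_le_sum _ (fun x : Fin (n + 1) → α =>
      ∏ j : Fin n, P (x j.castSucc) (x j.succ)) _ fun x hx => ?_).trans ?_
    · exact (Finset.mem_filter.1 hx).2
    · exact Finset.sum_le_sum_of_subset_of_nonneg (Finset.subset_univ _) fun x _ _ =>
        Finset.prod_nonneg fun _ _ => nonneg_of_mem_rowStochastic hP
  rw [Real.rpow_neg hd'.le, ← div_eq_mul_inv, div_le_iff₀ (by positivity)] at h1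
  exact h1

/-- Asymptotic equipartition: typical paths carry almost all the probability. -/
theorem tendsto_sum_typicalSet (hP : P ∈ rowStochastic ℝ α) (hirr : P.IsIrreducible)
    (hp : p ∈ stdSimplex ℝ α) {q : α → ℝ} (hq : IsStationary P q) {d : ℕ} (hd : 1 < d)
    {h : ℝ} (hh : condEntropy d P q < h) :
    Tendsto (fun n => ∑ x ∈ typicalSet d P h n, markovDist p P (n + 1) x) atTop (𝓝 1) := by
  classical
  have hd' : (1 : ℝ) < d := by exact_mod_cast hd
  set H := condEntropy d P q with hH
  let f : α → α → ℝ := fun u v => -Real.logb d (P u v)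
  have hqf : q ⬝ᵥ (fun u => ∑ v, P u v * f u v) = H := by
    rw [hH, condEntropy, Finset.sum_filter, dotProduct, ← Finset.sum_neg_distrib]
    refine Finset.sum_congr rfl fun u _ => ?_
    split_ifs with hu
    · rw [Finset.mul_sum, ← Finset.sum_neg_distrib]
      exact Finset.sum_congr rfl fun v _ => by simp only [f]; ring
    · rw [le_antisymm (not_lt.1 hu) (hq.1.1 u)]; simp
  have hq1 : q ⬝ᵥ 1 = 1 := by rw [dotProduct_one]; exact hq.1.2
  obtain ⟨g, hg⟩ := exists_poisson hP hirr hq ((fun u => ∑ v, P u v * f u v) - H • 1) (by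
    rw [dotProduct_sub, hqf, dotProduct_smul, hq1]; simp)
  -- The Poisson solution `g` corrects the centred log-probability to a martingale increment; the
  -- correction telescopes along a path.
  let D : α → α → ℝ := fun u v => f u v - H + g v - g u
  have hD : ∀ u, ∑ v, P u v * D u v = 0 := by
    intro u
    have h1 := congrFun hg u
    simp only [Pi.sub_apply, mulVec, dotProduct, Pi.smul_apply, Pi.one_apply, smul_eq_mul,
      mul_one] at h1
    calc ∑ v, P u v * D u v = ∑ v, (P u v * f u v - P u v * H + P u v * g v - P u v * g u) :=
          Finset.sum_congr rfl fun v _ => by simp only [D]; ring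
      _ = 0 := by
        simp only [Finset.sum_sub_distrib, Finset.sum_add_distrib, ← Finset.sum_mul,
          sum_row_of_mem_rowStochastic hP]
        linarith
  let B : ℝ := ∑ u, ∑ v, D u v ^ 2
  have hB : ∀ u v, D u v ^ 2 ≤ B := fun u v =>
    (Finset.single_le_sum (f := fun v => D u v ^ 2) (fun _ _ => sq_nonneg _)
      (Finset.mem_univ v)).trans (Finset.single_le_sum (f := fun u => ∑ v, D u v ^ 2)
      (fun _ _ => Finset.sum_nonneg fun _ _ => sq_nonneg _) (Finset.mem_univ u))
  let G : ℝ := ∑ u, |g u|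
  have hG : ∀ u, |g u| ≤ G := fun u =>
    Finset.single_le_sum (f := fun u => |g u|) (fun _ _ => abs_nonneg _) (Finset.mem_univ u)
  have hε : 0 < h - H := sub_pos.2 hh
  have htel : ∀ n (x : Fin (n + 1) → α),
      pathSum f n x = n * H + pathSum D n x + g (x 0) - g (x (Fin.last n)) := by
    intro n x
    have h1 : pathSum D n x = pathSum f n x - n * H
        + ∑ j : Fin n, (g (x j.succ) - g (x j.castSucc)) := by
      simp only [pathSum, D]
      rw [show (n : ℝ) * H = ∑ _j : Fin n, H by simp, ← Finset.sum_sub_distrib,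
        ← Finset.sum_add_distrib]
      exact Finset.sum_congr rfl fun j _ => by ring
    have h2 : ∑ j : Fin n, (g (x j.succ) - g (x j.castSucc)) = g (x (Fin.last n)) - g (x 0) := by
      have h3 := Fin.sum_univ_succ (fun i => g (x i))
      have h4 := Fin.sum_univ_castSucc (fun i => g (x i))
      rw [Finset.sum_sub_distrib]
      linarith
    linarith
  -- atypical paths have a large centred sum
  have hlarge : ∀ᶠ n : ℕ in atTop, ∀ x : Fin (n + 1) → α, x ∉ typicalSet d P h n →
      markovDist p P (n + 1) x ≠ 0 → (n * ((h - H) / 2)) ^ 2 ≤ pathSum D n x ^ 2 := by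
    have h1 : Tendsto (fun n : ℕ => (n : ℝ) * ((h - H) / 2)) atTop atTop :=
      tendsto_natCast_atTop_atTop.atTop_mul_const (by positivity)
    -- The telescoped boundary terms amount to at most `2 * G`, so for these `n` they use up no more
    -- than half of the excess `n * (h - H)`. Nonzero probability makes all transition factors
    -- nonzero, so that the logarithm splits.
    filter_upwards [h1.eventually_ge_atTop (2 * G)] with n hn x hx hx0
    have hprod : ∏ j : Fin n, P (x j.castSucc) (x j.succ) ≠ 0 := right_ne_zero_of_mul hx0
    have hlog : pathSum f n x = -Real.logb d (∏ j : Fin n, P (x j.castSucc) (x j.succ)) := by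
      rw [Real.logb_prod _ _ (fun j hj => Finset.prod_ne_zero_iff.1 hprod j hj), pathSum,
        ← Finset.sum_neg_distrib]
    have hpos : 0 < ∏ j : Fin n, P (x j.castSucc) (x j.succ) :=
      (Finset.prod_nonneg fun _ _ => nonneg_of_mem_rowStochastic hP).lt_of_ne' hprod
    have hlt : n * h < pathSum f n x := by
      simp only [typicalSet, Finset.mem_filter, Finset.mem_univ, true_and, not_le] at hx
      have := (Real.logb_lt_iff_lt_rpow hd' hpos).2 hx
      linarith
    rw [htel] at hlt
    have h3 := (abs_le.1 (hG (x 0))).2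
    have h4 := (abs_le.1 (hG (x (Fin.last n)))).1
    have h5 : (n : ℝ) * ((h - H) / 2) ≤ pathSum D n x := by nlinarith
    exact pow_le_pow_left₀ (by positivity) h5 2
  have hbound : ∀ᶠ n : ℕ in atTop, 1 - B / ((h - H) / 2) ^ 2 / n ≤
      ∑ x ∈ typicalSet d P h n, markovDist p P (n + 1) x := by
    filter_upwards [hlarge, eventually_gt_atTop 0] with n hn hn0
    have hn0' : (0 : ℝ) < n := by exact_mod_cast hn0
    -- Chebyshev's inequality: the variance is linear in `n`, the squared threshold quadratic.
    have h1 : ∑ x ∈ (typicalSet d P h n)ᶜ, markovDist p P (n + 1) x * (n * ((h - H) / 2)) ^ 2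
        ≤ n * B := by
      refine le_trans ?_ (sum_markovDist_mul_pathSum_sq_le hP hp hD hB n)
      refine (Finset.sum_le_sum fun x hx => ?_).trans
        (Finset.sum_le_sum_of_subset_of_nonneg (Finset.subset_univ _) fun x _ _ =>
          mul_nonneg (markovDist_nonneg hP hp _ x) (sq_nonneg _))
      rcases eq_or_ne (markovDist p P (n + 1) x) 0 with h0 | h0
      · simp [h0]
      · exact mul_le_mul_of_nonneg_left (hn x (Finset.mem_compl.1 hx) h0)
          (markovDist_nonneg hP hp _ x)
    rw [← Finset.sum_mul, ← le_div_iff₀ (by positivity)] at h1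
    have h2 : n * B / (n * ((h - H) / 2)) ^ 2 = B / ((h - H) / 2) ^ 2 / n := by
      field_simp
    have h3 := Finset.sum_add_sum_compl (typicalSet d P h n) (markovDist p P (n + 1))
    rw [sum_markovDist hP hp] at h3
    linarith
  refine tendsto_of_tendsto_of_tendsto_of_le_of_le' (g := fun n : ℕ =>
    1 - B / ((h - H) / 2) ^ 2 / n) ?_ tendsto_const_nhds hbound (Eventually.of_forall fun n => ?_)
  · have := (tendsto_const_div_atTop_nhds_zero_nat (B / ((h - H) / 2) ^ 2)).const_sub 1
    rwa [sub_zero] at this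
  · rw [← sum_markovDist hP hp (n + 1)]
    exact Finset.sum_le_sum_of_subset_of_nonneg (Finset.subset_univ _) fun x _ _ =>
      markovDist_nonneg hP hp _ x

end Equipartition

/-! ### Kraus operators, fidelity and recovery. -/

section Operations

variable {α : Type} [Fintype α]

theorem operatorSum_apply {ι : Type} [Fintype ι] (K : ι → Matrix α α ℂ) (ρ : Matrix α α ℂ) :
    operatorSum K ρ = ∑ i, K i * ρ * (K i)ᴴ := rfl

theorem operatorSum_comp {ι κ : Type} [Fintype ι] [Fintype κ] (K : ι → Matrix α α ℂ)
    (M : κ → Matrix α α ℂ) :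
    operatorSum K ∘ₗ operatorSum M = operatorSum fun ij : κ × ι => K ij.2 * M ij.1 := by
  refine LinearMap.ext fun ρ => ?_
  simp only [LinearMap.comp_apply, operatorSum_apply, Fintype.sum_prod_type, Finset.mul_sum,
    Finset.sum_mul, conjTranspose_mul]
  rw [Finset.sum_comm]
  simp only [Matrix.mul_assoc]

theorem isTPCP_operatorSum [DecidableEq α] {ι : Type} [Fintype ι] (K : ι → Matrix α α ℂ)
    (hK : ∑ i, (K i)ᴴ * K i = 1) : IsTPCP (operatorSum K) := by
  refine ⟨fun k B hB => ?_, fun ρ => ?_⟩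
  · let T : ι → Matrix (Fin k × α) (Fin k × α) ℂ := fun i =>
      Matrix.of fun s t => if s.1 = t.1 then K i s.2 t.2 else 0
    have h : (Matrix.of fun s t : Fin k × α =>
        operatorSum K (Matrix.of fun a b => B (s.1, a) (t.1, b)) s.2 t.2) =
        ∑ i, T i * B * (T i)ᴴ := by
      ext s t
      simp only [operatorSum_apply, of_apply, Matrix.sum_apply, mul_apply, conjTranspose_apply, T,
        Fintype.sum_prod_type, ite_mul, zero_mul, apply_ite star, star_zero, mul_ite, mul_zero]
      refine Finset.sum_congr rfl fun i _ => ?_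
      rw [Finset.sum_eq_single t.1]
      · refine Finset.sum_congr rfl fun b _ => ?_
        rw [if_pos rfl, Finset.sum_eq_single s.1]
        · simp
        · intro c _ hc
          simp [hc.symm]
        · simp
      · intro c _ hc
        simp [hc.symm]
      · simp
    rw [h]
    exact posSemidef_sum _ fun i _ => hB.mul_mul_conjTranspose_same _
  · have h : ∀ i, (K i * ρ * (K i)ᴴ).trace = ((K i)ᴴ * K i * ρ).trace := fun i => by
      rw [Matrix.trace_mul_comm, Matrix.mul_assoc]
    rw [operatorSum_apply, trace_sum, Finset.sum_congr rfl fun i _ => h i, ← trace_sum,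
      ← Finset.sum_mul, hK, Matrix.one_mul]

theorem IsCompletelyPositive.posSemidef {Φ : Matrix α α ℂ →ₗ[ℂ] Matrix α α ℂ}
    (hΦ : IsCompletelyPositive Φ) {ρ : Matrix α α ℂ} (hρ : ρ.PosSemidef) : (Φ ρ).PosSemidef := by
  have h := (hΦ 1 (ρ.submatrix Prod.snd Prod.snd) (hρ.submatrix _)).submatrix
    (fun a : α => ((0 : Fin 1), a))
  exact h

theorem star_dotProduct_self (ψ : EuclideanSpace ℂ α) :
    star ψ.ofLp ⬝ᵥ ψ.ofLp = ((‖ψ‖ ^ 2 : ℝ) : ℂ) := by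
  have h := inner_self_eq_norm_sq_to_K (𝕜 := ℂ) ψ
  rw [EuclideanSpace.inner_eq_star_dotProduct, dotProduct_comm] at h
  rw [h]
  norm_cast

theorem star_dotProduct_self_of_norm_eq_one {ψ : EuclideanSpace ℂ α} (hψ : ‖ψ‖ = 1) :
    star ψ.ofLp ⬝ᵥ ψ.ofLp = 1 := by
  rw [star_dotProduct_self, hψ]
  norm_num

/-- The difference is the trace of `E ρ E`, with `E` the projection onto the complement of `v`. -/
theorem dotProduct_mulVec_le_trace [DecidableEq α] {ρ : Matrix α α ℂ} (hρ : ρ.PosSemidef)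
    {v : α → ℂ} (hv : star v ⬝ᵥ v = 1) : star v ⬝ᵥ (ρ *ᵥ v) ≤ ρ.trace := by
  let E : Matrix α α ℂ := 1 - vecMulVec v (star v)
  have hV : vecMulVec v (star v) * vecMulVec v (star v) = vecMulVec v (star v) := by
    rw [vecMulVec_mul_vecMulVec, hv, one_smul]
  have hE : Eᴴ = E := by
    simp [E, conjTranspose_sub, conjTranspose_vecMulVec]
  have hEE : E * E = E := by
    simp [E, Matrix.mul_sub, Matrix.sub_mul, hV]
  have h := (hρ.mul_mul_conjTranspose_same E).trace_nonneg
  rw [hE, Matrix.mul_assoc, Matrix.trace_mul_comm, Matrix.mul_assoc, hEE] at h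
  have h2 : (ρ * E).trace = ρ.trace - star v ⬝ᵥ (ρ *ᵥ v) := by
    rw [Matrix.mul_sub, Matrix.mul_one, trace_sub, mul_vecMulVec, trace_vecMulVec, dotProduct_comm]
  rw [h2] at h
  exact sub_nonneg.1 h

theorem IsTPCP.pureFidelity_nonneg {Φ Ψ : Matrix α α ℂ →ₗ[ℂ] Matrix α α ℂ}
    (hΦ : IsTPCP Φ) (hΨ : IsTPCP Ψ) (ψ : EuclideanSpace ℂ α) :
    0 ≤ pureFidelity (Φ ∘ₗ Ψ) ψ :=
  (Complex.nonneg_iff.1 ((hΦ.1.posSemidef (hΨ.1.posSemidef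
    (posSemidef_vecMulVec_self_star _))).dotProduct_mulVec_nonneg _)).1

theorem IsTPCP.pureFidelity_le_one {Φ Ψ : Matrix α α ℂ →ₗ[ℂ] Matrix α α ℂ}
    (hΦ : IsTPCP Φ) (hΨ : IsTPCP Ψ) {ψ : EuclideanSpace ℂ α} (hψ : ‖ψ‖ = 1) :
    pureFidelity (Φ ∘ₗ Ψ) ψ ≤ 1 := by
  classical
  have h1 := star_dotProduct_self_of_norm_eq_one hψ
  have h := dotProduct_mulVec_le_trace (hΦ.1.posSemidef (hΨ.1.posSemidef
    (posSemidef_vecMulVec_self_star ψ.ofLp))) h1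
  rw [hΦ.2, hΨ.2, trace_vecMulVec, dotProduct_comm ψ.ofLp, h1] at h
  exact (Complex.le_def.1 h).1

theorem pureFidelity_operatorSum {ι : Type} [Fintype ι] (K : ι → Matrix α α ℂ)
    (ψ : EuclideanSpace ℂ α) :
    pureFidelity (operatorSum K) ψ = ∑ i, Complex.normSq (star ψ.ofLp ⬝ᵥ (K i *ᵥ ψ.ofLp)) := by
  rw [pureFidelity, operatorSum_apply, sum_mulVec, dotProduct_sum, Complex.re_sum]
  refine Finset.sum_congr rfl fun i _ => ?_
  have h : star ψ.ofLp ⬝ᵥ ((K i * vecMulVec ψ.ofLp (star ψ.ofLp) * (K i)ᴴ) *ᵥ ψ.ofLp) =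
      (star ψ.ofLp ⬝ᵥ (K i *ᵥ ψ.ofLp)) * star (star ψ.ofLp ⬝ᵥ (K i *ᵥ ψ.ofLp)) := by
    rw [mul_vecMulVec, vecMulVec_mul, vecMulVec_mulVec, ← star_mulVec]
    rw [← star_dotProduct_star, star_star, dotProduct_comm (star ψ.ofLp) (K i *ᵥ ψ.ofLp)]
    simp [mul_comm, dotProduct_comm]
  rw [h, Complex.star_def, Complex.mul_conj, Complex.ofReal_re]

theorem exists_projection_matrix [DecidableEq α] (C : Submodule ℂ (EuclideanSpace ℂ α)) :
    ∃ E : Matrix α α ℂ, Eᴴ = E ∧ E * E = E ∧ (∀ v ∈ C, E *ᵥ v.ofLp = v.ofLp) ∧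
      ∀ w : α → ℂ, ∃ v ∈ C, E *ᵥ w = v.ofLp := by
  have hp : IsStarProjection C.starProjection := isStarProjection_starProjection
  obtain ⟨E, hE⟩ := EquivLike.surjective (toEuclideanCLM (n := α) (𝕜 := ℂ)) C.starProjection
  have hinj := EquivLike.injective (toEuclideanCLM (n := α) (𝕜 := ℂ))
  have happ : ∀ v : EuclideanSpace ℂ α, E *ᵥ v.ofLp = (C.starProjection v).ofLp := fun v => by
    rw [← hE, ofLp_toEuclideanCLM]
  refine ⟨E, hinj ?_, hinj ?_, fun v hv => ?_, fun w => ?_⟩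
  · rw [← star_eq_conjTranspose, map_star, hE, hp.isSelfAdjoint.star_eq]
  · rw [map_mul, hE, hp.isIdempotentElem.eq]
  · rw [happ, Submodule.starProjection_eq_self_iff.2 hv]
  · exact ⟨C.starProjection (WithLp.toLp 2 w), Submodule.starProjection_apply_mem _ _,
      happ (WithLp.toLp 2 w)⟩

theorem projection_mul_conjTranspose_mul_eq_zero [DecidableEq α] {E M N : Matrix α α ℂ}
    (hE : Eᴴ = E)
    (h : ∀ v w : α → ℂ, star (M *ᵥ E *ᵥ v) ⬝ᵥ (N *ᵥ E *ᵥ w) = 0) :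
    E * Mᴴ * (N * E) = 0 := by
  refine ext_of_mulVec_single fun b => funext fun a => ?_
  have h0 := h (Pi.single a 1) (Pi.single b 1)
  have h1 : star (Pi.single a 1 : α → ℂ) = Pi.single a 1 := by
    rw [← Pi.single_star, star_one]
  rw [star_mulVec, star_mulVec, hE, h1, ← dotProduct_mulVec,
    ← dotProduct_mulVec, single_one_dotProduct] at h0
  rw [zero_mulVec, Pi.zero_apply, ← h0]
  simp only [mulVec_mulVec, Matrix.mul_assoc]

/-- The recovery operators for the errors `N x`, `x ∈ J`, of a code with projection `E`. -/
noncomputable def recoveryKraus [DecidableEq α] {ι : Type} (N : ι → Matrix α α ℂ) (J : Finset ι)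
    (E : Matrix α α ℂ) (o : Option J) : Matrix α α ℂ :=
  o.elim (1 - ∑ x ∈ J, N x * E * (N x)ᴴ) fun x => E * (N x)ᴴ

/-- The images of the code under the errors in `J` are orthogonal, so `S` is a projection; the extra
operator `1 - S` completes the resolution of the identity. -/
theorem sum_recoveryKraus [DecidableEq α] {ι : Type} [DecidableEq ι]
    {N : ι → Matrix α α ℂ} (hN : ∀ x, (N x)ᴴ * N x = 1) {J : Finset ι} {E : Matrix α α ℂ}
    (hE : Eᴴ = E) (hEE : E * E = E)
    (hKL : ∀ x ∈ J, ∀ y ∈ J, x ≠ y → E * (N x)ᴴ * (N y * E) = 0) :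
    ∑ o, (recoveryKraus N J E o)ᴴ * recoveryKraus N J E o = 1 := by
  set S : Matrix α α ℂ := ∑ x ∈ J, N x * E * (N x)ᴴ with hSdef
  have hS : Sᴴ = S := by
    simp only [S, conjTranspose_sum, conjTranspose_mul, conjTranspose_conjTranspose, hE,
      Matrix.mul_assoc]
  have hSS : S * S = S := by
    simp only [S, Finset.sum_mul, Finset.mul_sum]
    refine Finset.sum_congr rfl fun x hx => ?_
    rw [Finset.sum_eq_single x]
    · calc N x * E * (N x)ᴴ * (N x * E * (N x)ᴴ)
          = N x * E * ((N x)ᴴ * N x) * E * (N x)ᴴ := by simp only [Matrix.mul_assoc]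
        _ = N x * (E * E) * (N x)ᴴ := by rw [hN, Matrix.mul_one, Matrix.mul_assoc (N x)]
        _ = N x * E * (N x)ᴴ := by rw [hEE]
    · intro y hy hyx
      calc N y * E * (N y)ᴴ * (N x * E * (N x)ᴴ)
          = N y * (E * (N y)ᴴ * (N x * E)) * (N x)ᴴ := by simp only [Matrix.mul_assoc]
        _ = 0 := by rw [hKL y hy x hx hyx, Matrix.mul_zero, Matrix.zero_mul]
    · exact fun h => absurd hx h
  have h1 : (1 - S)ᴴ * (1 - S) = 1 - S := by
    rw [conjTranspose_sub, hS, conjTranspose_one, Matrix.mul_sub, Matrix.mul_one,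
      Matrix.sub_mul, Matrix.one_mul, hSS, sub_self, sub_zero]
  have h2 : ∑ x : J, (E * (N x)ᴴ)ᴴ * (E * (N x)ᴴ) = S := by
    rw [hSdef, ← Finset.sum_coe_sort J]
    refine Finset.sum_congr rfl fun x _ => ?_
    rw [conjTranspose_mul, conjTranspose_conjTranspose, hE, Matrix.mul_assoc,
      ← Matrix.mul_assoc E, hEE, Matrix.mul_assoc]
  rw [Fintype.sum_option]
  simp only [recoveryKraus, Option.elim]
  rw [← hSdef, h1, h2, sub_add_cancel]

/-- The fidelity is a sum of squared moduli over pairs of Kraus operators; one good pair is kept for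
each `x ∈ J`. -/
theorem le_pureFidelity_comp {ι κ : Type} [Fintype ι] [Fintype κ] (K : κ → Matrix α α ℂ)
    (M : ι → Matrix α α ℂ) (ψ : EuclideanSpace ℂ α) (J : Finset ι) (w : ι → ℝ)
    (h : ∀ x ∈ J, ∃ o, w x ≤ Complex.normSq (star ψ.ofLp ⬝ᵥ ((K o * M x) *ᵥ ψ.ofLp))) :
    ∑ x ∈ J, w x ≤ pureFidelity (operatorSum K ∘ₗ operatorSum M) ψ := by
  rw [operatorSum_comp, pureFidelity_operatorSum, Fintype.sum_prod_type]
  refine (Finset.sum_le_sum fun x hx => ?_).trans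
    (Finset.sum_le_sum_of_subset_of_nonneg (Finset.subset_univ J) fun _ _ _ =>
        Finset.sum_nonneg fun _ _ => Complex.normSq_nonneg _)
  obtain ⟨o, ho⟩ := h x hx
  exact ho.trans (Finset.single_le_sum (f := fun o => Complex.normSq (star ψ.ofLp ⬝ᵥ
    ((K o * M x) *ᵥ ψ.ofLp))) (fun _ _ => Complex.normSq_nonneg _) (Finset.mem_univ o))

/-- If the errors in `J` map the code to mutually orthogonal subspaces, some recovery operation
corrects all of them. -/
theorem exists_recovery [DecidableEq α] {ι : Type} [Fintype ι] [DecidableEq ι]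
    (N : ι → Matrix α α ℂ) (hN : ∀ x, (N x)ᴴ * N x = 1) {w : ι → ℝ} (hw : ∀ x, 0 ≤ w x)
    (J : Finset ι) (C : Submodule ℂ (EuclideanSpace ℂ α))
    (horth : ∀ x ∈ J, ∀ y ∈ J, x ≠ y → ∀ v ∈ C, ∀ v' ∈ C,
      star (N x *ᵥ v.ofLp) ⬝ᵥ (N y *ᵥ v'.ofLp) = 0) :
    ∃ ℛ : Matrix α α ℂ →ₗ[ℂ] Matrix α α ℂ, IsTPCP ℛ ∧ ∀ ψ ∈ C, ‖ψ‖ = 1 →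
      ∑ x ∈ J, w x ≤
        pureFidelity (ℛ ∘ₗ operatorSum fun x => ((√(w x) : ℝ) : ℂ) • N x) ψ := by
  obtain ⟨E, hE, hEE, hfix, hran⟩ := exists_projection_matrix C
  have hKL : ∀ x ∈ J, ∀ y ∈ J, x ≠ y → E * (N x)ᴴ * (N y * E) = 0 := by
    intro x hx y hy hxy
    refine projection_mul_conjTranspose_mul_eq_zero hE fun a b => ?_
    obtain ⟨v, hv, hv'⟩ := hran a
    obtain ⟨v', hvm', hv''⟩ := hran b
    rw [hv', hv'']
    exact horth x hx y hy hxy v hv v' hvm'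
  refine ⟨operatorSum (recoveryKraus N J E),
    isTPCP_operatorSum _ (sum_recoveryKraus hN hE hEE hKL), fun ψ hψ hψ1 => ?_⟩
  refine le_pureFidelity_comp _ _ ψ J w fun x hx => ⟨some ⟨x, hx⟩, le_of_eq ?_⟩
  simp only [recoveryKraus, Option.elim]
  rw [Matrix.mul_smul, Matrix.mul_assoc, hN, Matrix.mul_one, smul_mulVec, hfix ψ hψ,
    dotProduct_smul, star_dotProduct_self_of_norm_eq_one hψ1,
    smul_eq_mul, mul_one, Complex.normSq_ofReal, Real.mul_self_sqrt (hw x)]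

end Operations

/-! ### Bounds for the minimum and optimal fidelities. -/

section Fidelity

variable {α : Type} [Fintype α]

theorem exists_norm_eq_one {C : Submodule ℂ (EuclideanSpace ℂ α)} (hC : C ≠ ⊥) :
    ∃ ψ ∈ C, ‖ψ‖ = 1 := by
  obtain ⟨v, hv, hv0⟩ := Submodule.exists_mem_ne_zero_of_ne_bot hC
  refine ⟨((‖v‖⁻¹ : ℝ) : ℂ) • v, C.smul_mem _ hv, ?_⟩
  rw [norm_smul, Complex.norm_real, norm_inv, norm_norm, inv_mul_cancel₀ (norm_ne_zero_iff.2 hv0)]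

theorem minFidelity_le_one {C : Submodule ℂ (EuclideanSpace ℂ α)} (hC : C ≠ ⊥)
    {Φ Ψ : Matrix α α ℂ →ₗ[ℂ] Matrix α α ℂ} (hΦ : IsTPCP Φ) (hΨ : IsTPCP Ψ) :
    minFidelity C (Φ ∘ₗ Ψ) ≤ 1 := by
  obtain ⟨ψ, hψ, hψ1⟩ := exists_norm_eq_one hC
  refine le_trans (csInf_le ⟨0, ?_⟩ ?_) (hΦ.pureFidelity_le_one hΨ hψ1)
  swap
  · exact ⟨ψ, hψ, hψ1, rfl⟩
  rintro _ ⟨φ, -, -, rfl⟩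
  exact hΦ.pureFidelity_nonneg hΨ φ

theorem le_minFidelity {C : Submodule ℂ (EuclideanSpace ℂ α)} (hC : C ≠ ⊥)
    {Φ : Matrix α α ℂ →ₗ[ℂ] Matrix α α ℂ} {c : ℝ}
    (h : ∀ ψ ∈ C, ‖ψ‖ = 1 → c ≤ pureFidelity Φ ψ) : c ≤ minFidelity C Φ := by
  obtain ⟨ψ, hψ, hψ1⟩ := exists_norm_eq_one hC
  refine le_csInf ⟨_, ψ, hψ, hψ1, rfl⟩ ?_
  rintro _ ⟨φ, hφ, hφ1, rfl⟩
  exact h φ hφ hφ1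

theorem le_optFidelity {d : ℕ} [NeZero d] {n : ℕ} {k : ℝ} {A ℛ : OpMap d n} (hA : IsTPCP A)
    (hℛ : IsTPCP ℛ) {C : Submodule ℂ (EuclideanSpace ℂ (Fin n → ZMod d))} (hC : C ≠ ⊥)
    (hk : k ≤ Real.logb d (Module.finrank ℂ C)) {c : ℝ}
    (h : ∀ ψ ∈ C, ‖ψ‖ = 1 → c ≤ pureFidelity (ℛ ∘ₗ A) ψ) : c ≤ optFidelity d n k A := by
  refine (le_minFidelity hC h).trans (le_csSup ⟨1, ?_⟩ ⟨C, ℛ, hC, hk, hℛ, rfl⟩)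
  rintro _ ⟨C', ℛ', hC', -, hℛ', rfl⟩
  exact minFidelity_le_one hC' hℛ' hA

theorem optFidelity_le_one {d : ℕ} [NeZero d] {n : ℕ} {k : ℝ} {A : OpMap d n} (hA : IsTPCP A) :
    optFidelity d n k A ≤ 1 := by
  refine Real.sSup_le ?_ zero_le_one
  rintro _ ⟨C', ℛ', hC', -, hℛ', rfl⟩
  exact minFidelity_le_one hC' hℛ' hA

end Fidelity

/-! ### The symplectic form on error labels. -/

section Symplectic

variable {d n : ℕ}

/-- The `X`-exponents of an error label. -/
def xPart (x : Fin n → Lbl d) : Fin n → ZMod d := fun i => (x i).1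

/-- The `Z`-exponents of an error label. -/
def zPart (x : Fin n → Lbl d) : Fin n → ZMod d := fun i => (x i).2

/-- The symplectic form on error labels. -/
def sympl (x y : Fin n → Lbl d) : ZMod d := xPart x ⬝ᵥ zPart y - xPart y ⬝ᵥ zPart x

theorem sympl_sub_right (x y z : Fin n → Lbl d) : sympl x (y - z) = sympl x y - sympl x z := by
  have h1 : xPart (y - z) = xPart y - xPart z := rfl
  have h2 : zPart (y - z) = zPart y - zPart z := rfl
  rw [sympl, sympl, sympl, h1, h2, dotProduct_sub, sub_dotProduct]
  ring

end Symplectic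

/-! ### Weyl operators and their commutation relations. -/

section Weyl

variable {d : ℕ} [NeZero d] {ω : ℂ}

theorem weylX_pow_apply (k : ℕ) (a b : ZMod d) :
    (weylX d ^ k) a b = if a = b - k then 1 else 0 := by
  induction k generalizing a with
  | zero => simp [one_apply]
  | succ k ih =>
    rw [pow_succ', mul_apply, Finset.sum_eq_single (a + 1)]
    · rw [ih]
      have h1 : weylX d a (a + 1) = 1 := by simp [weylX]
      have h2 : a + 1 = b - k ↔ a = b - ((k + 1 : ℕ) : ZMod d) := by
        push_cast
        constructor <;> intro h <;> linear_combination h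
      simp only [h1, h2, one_mul]
    · intro c _ hc
      have : weylX d a c = 0 := by
        simp only [weylX, of_apply, ite_eq_right_iff, one_ne_zero, imp_false]
        exact fun h => hc (by rw [h]; ring)
      rw [this, zero_mul]
    · simp

theorem weylN_apply (hω : ω ^ d = 1) (x : Lbl d) (a b : ZMod d) :
    weylN d ω x a b = if a = b - x.1 then AddChar.zmodChar d hω (b * x.2) else 0 := by
  rw [weylN, weylZ, diagonal_pow, mul_diagonal, weylX_pow_apply, ZMod.natCast_zmod_val]
  have h : AddChar.zmodChar d hω (b * x.2) = (ω ^ b.val) ^ x.2.val := by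
    rw [← pow_mul, ← AddChar.zmodChar_apply' hω, Nat.cast_mul, ZMod.natCast_zmod_val,
      ZMod.natCast_zmod_val]
  rw [h]
  simp

variable {n : ℕ}

theorem weylTensor_apply (hω : ω ^ d = 1) (x : Fin n → Lbl d) (a b : Fin n → ZMod d) :
    weylTensor d ω n x a b =
      if a = b - xPart x then AddChar.zmodChar d hω (b ⬝ᵥ zPart x) else 0 := by
  simp only [weylTensor, of_apply, weylN_apply hω]
  rw [Finset.prod_ite_zero]
  have h : (∀ i ∈ Finset.univ, a i = b i - (x i).1) ↔ a = b - xPart x := by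
    simp [funext_iff, xPart]
  have h2 : AddChar.zmodChar d hω (∑ i, b i * (x i).2) =
      ∏ i, AddChar.zmodChar d hω (b i * (x i).2) :=
    map_prod (AddChar.zmodChar d hω).toMonoidHom (fun i => Multiplicative.ofAdd (b i * (x i).2)) _
  simp only [h, dotProduct, zPart, h2]

theorem norm_zmodChar (hω : ω ^ d = 1) (a : ZMod d) : ‖AddChar.zmodChar d hω a‖ = 1 :=
  AddChar.norm_apply _ a

theorem weylTensor_conjTranspose_mul_self (hω : ω ^ d = 1) (x : Fin n → Lbl d) :
    (weylTensor d ω n x)ᴴ * weylTensor d ω n x = 1 := by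
  ext a b
  rw [mul_apply, Finset.sum_eq_single (b - xPart x)]
  · rw [conjTranspose_apply, weylTensor_apply hω, weylTensor_apply hω, if_pos rfl, one_apply]
    by_cases hab : a = b
    · subst hab
      rw [if_pos rfl, if_pos rfl, Complex.star_def, mul_comm, Complex.mul_conj,
        Complex.normSq_eq_norm_sq, norm_zmodChar]
      norm_num
    · rw [if_neg hab, if_neg (fun h => hab (sub_left_injective h).symm), star_zero, zero_mul]
  · intro c _ hc
    rw [weylTensor_apply hω x c b, if_neg hc, mul_zero]
  · simp

theorem weylTensor_mul (hω : ω ^ d = 1) (x y : Fin n → Lbl d) :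
    weylTensor d ω n x * weylTensor d ω n y =
      AddChar.zmodChar d hω (-(xPart y ⬝ᵥ zPart x)) • weylTensor d ω n (x + y) := by
  ext a b
  rw [mul_apply, Finset.sum_eq_single (b - xPart y)]
  · rw [Matrix.smul_apply, weylTensor_apply hω, weylTensor_apply hω, weylTensor_apply hω, if_pos rfl]
    have h1 : xPart (x + y) = xPart x + xPart y := rfl
    have h2 : zPart (x + y) = zPart x + zPart y := rfl
    have h3 : a = b - xPart y - xPart x ↔ a = b - xPart (x + y) := by
      rw [h1, sub_sub, add_comm]
    simp only [h3]
    split_ifs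
    · rw [smul_eq_mul, ← AddChar.map_add_eq_mul, ← AddChar.map_add_eq_mul, h2, sub_dotProduct,
        dotProduct_add]
      congr 1
      ring
    · simp
  · intro c _ hc
    rw [weylTensor_apply hω y c b, if_neg hc, mul_zero]
  · simp

theorem weylTensor_mul_comm (hω : ω ^ d = 1) (x y : Fin n → Lbl d) :
    weylTensor d ω n x * weylTensor d ω n y =
      AddChar.zmodChar d hω (sympl x y) • (weylTensor d ω n y * weylTensor d ω n x) := by
  rw [weylTensor_mul hω, weylTensor_mul hω, smul_smul, ← AddChar.map_add_eq_mul, add_comm y x]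
  congr 2
  rw [sympl]
  ring

theorem weylTensor_commute (hω : ω ^ d = 1) {x y : Fin n → Lbl d} (h : sympl x y = 0) :
    Commute (weylTensor d ω n x) (weylTensor d ω n y) := by
  rw [Commute, SemiconjBy, weylTensor_mul_comm hω, h, AddChar.map_zero_eq_one, one_smul]

theorem weylTensor_zero (hω : ω ^ d = 1) : weylTensor d ω n 0 = 1 := by
  ext a b
  have h1 : xPart (0 : Fin n → Lbl d) = 0 := rfl
  have h2 : zPart (0 : Fin n → Lbl d) = 0 := rfl
  rw [weylTensor_apply hω, h1, h2, sub_zero, dotProduct_zero, AddChar.map_zero_eq_one, one_apply]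

/-- Powers of `N_x` are multiples of `N_{kx}`, and `d • x = 0`. The scalar need not be identified
for the eigenspace count. -/
theorem exists_weylTensor_pow (hω : ω ^ d = 1) (x : Fin n → Lbl d) :
    ∃ c : ℂ, weylTensor d ω n x ^ d = c • (1 : Matrix (Fin n → ZMod d) (Fin n → ZMod d) ℂ) := by
  have h : ∀ k : ℕ, ∃ c : ℂ, weylTensor d ω n x ^ k = c • weylTensor d ω n (k • x) := by
    intro k
    induction k with
    | zero => exact ⟨1, by rw [pow_zero, zero_smul, weylTensor_zero hω, one_smul]⟩
    | succ k ih =>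
      obtain ⟨c, hc⟩ := ih
      refine ⟨c * AddChar.zmodChar d hω (-(xPart x ⬝ᵥ zPart (k • x))), ?_⟩
      rw [pow_succ, hc, smul_mul_assoc, weylTensor_mul hω, smul_smul, succ_nsmul]
  obtain ⟨c, hc⟩ := h d
  refine ⟨c, ?_⟩
  have h0 : d • x = 0 := by
    ext i <;> simp
  rw [hc, h0, weylTensor_zero hω]

theorem zmodChar_ne_one (hω : IsPrimitiveRoot ω d) {a : ZMod d} (ha : a ≠ 0) :
    AddChar.zmodChar d hω.pow_eq_one a ≠ 1 := by
  rw [AddChar.zmodChar_apply]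
  intro h
  have h1 := hω.dvd_of_pow_eq_one _ h
  have h2 := Nat.eq_zero_of_dvd_of_lt h1 (ZMod.val_lt a)
  exact ha ((ZMod.val_eq_zero a).1 h2)

/-- Errors with different syndromes map a joint eigenvector space to orthogonal subspaces. -/
theorem weylTensor_orthogonal (hω : IsPrimitiveRoot ω d) {s x y : Fin n → Lbl d}
    (hs : sympl s (x - y) ≠ 0) {μ : ℂ} {v w : (Fin n → ZMod d) → ℂ}
    (hv : weylTensor d ω n s *ᵥ v = μ • v) (hw : weylTensor d ω n s *ᵥ w = μ • w) :
    star (weylTensor d ω n y *ᵥ v) ⬝ᵥ (weylTensor d ω n x *ᵥ w) = 0 := by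
  set χ := AddChar.zmodChar d hω.pow_eq_one with hχ
  have hiso : ∀ a b : (Fin n → ZMod d) → ℂ,
      star (weylTensor d ω n s *ᵥ a) ⬝ᵥ (weylTensor d ω n s *ᵥ b) = star a ⬝ᵥ b := by
    intro a b
    rw [star_mulVec, ← dotProduct_mulVec, mulVec_mulVec,
      weylTensor_conjTranspose_mul_self hω.pow_eq_one, one_mulVec]
  -- An error shifts the eigenvalue of `N_s` by the character of its syndrome. Since `N_s` is an
  -- isometry, distinct eigenvalues give orthogonality.
  have hact : ∀ (z : Fin n → Lbl d) (a : (Fin n → ZMod d) → ℂ),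
      weylTensor d ω n s *ᵥ a = μ • a →
      weylTensor d ω n s *ᵥ (weylTensor d ω n z *ᵥ a) =
        (χ (sympl s z) * μ) • (weylTensor d ω n z *ᵥ a) := by
    intro z a ha
    rw [mulVec_mulVec, weylTensor_mul_comm hω.pow_eq_one, smul_mulVec, ← mulVec_mulVec, ha,
      mulVec_smul, smul_smul]
  rcases eq_or_ne v 0 with rfl | hv0
  · simp
  have hμ : star μ * μ = 1 := by
    have h1 := hiso v v
    rw [hv, star_smul, smul_dotProduct, dotProduct_smul, smul_smul, smul_eq_mul] at h1
    exact mul_right_cancel₀ (dotProduct_star_self_eq_zero.not.2 hv0)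
      (h1.trans (one_mul _).symm)
  have h1 := hiso (weylTensor d ω n y *ᵥ v) (weylTensor d ω n x *ᵥ w)
  rw [hact y v hv, hact x w hw, star_smul, smul_dotProduct, dotProduct_smul, smul_smul,
    smul_eq_mul] at h1
  have h2 : star (χ (sympl s y) * μ) * (χ (sympl s x) * μ) = χ (sympl s (x - y)) := by
    have h3 : star (χ (sympl s y)) * χ (sympl s y) = 1 := by
      rw [Complex.star_def, mul_comm, Complex.mul_conj, Complex.normSq_eq_norm_sq, norm_zmodChar]
      norm_num
    have h4 : χ (sympl s x) = χ (sympl s (x - y)) * χ (sympl s y) := by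
      rw [← AddChar.map_add_eq_mul, sympl_sub_right, sub_add_cancel]
    rw [star_mul', h4]
    linear_combination (χ (sympl s (x - y)) * (star μ * μ)) * h3 + χ (sympl s (x - y)) * hμ
  rw [h2] at h1
  by_contra hne
  exact zmodChar_ne_one hω hs (mul_right_cancel₀ hne (h1.trans (one_mul _).symm))

theorem isTPCP_markovChannel (hω : ω ^ d = 1) {P : Matrix (Lbl d) (Lbl d) ℝ}
    (hP : P ∈ rowStochastic ℝ (Lbl d)) {p : Lbl d → ℝ} (hp : p ∈ stdSimplex ℝ (Lbl d)) (n : ℕ) :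
    IsTPCP (markovChannel d ω p P n) := by
  refine isTPCP_operatorSum _ ?_
  have h : ∀ x : Fin n → Lbl d, (((√(markovDist p P n x) : ℝ) : ℂ) • weylTensor d ω n x)ᴴ *
      (((√(markovDist p P n x) : ℝ) : ℂ) • weylTensor d ω n x) =
      ((markovDist p P n x : ℝ) : ℂ) • (1 : Matrix (Fin n → ZMod d) (Fin n → ZMod d) ℂ) := by
    intro x
    rw [conjTranspose_smul, smul_mul_smul_comm, weylTensor_conjTranspose_mul_self hω,
      Complex.star_def, Complex.conj_ofReal, ← Complex.ofReal_mul,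
      Real.mul_self_sqrt (markovDist_nonneg hP hp n x)]
  rw [Finset.sum_congr rfl fun x _ => h x, ← Finset.sum_smul, ← Complex.ofReal_sum,
    sum_markovDist hP hp, Complex.ofReal_one, one_smul]

end Weyl

/-! ### Dimension bounds for joint eigenspaces. -/

section Eigenspaces

open Module Polynomial

variable {V : Type} [AddCommGroup V] [Module ℂ V] [FiniteDimensional ℂ V]

/-- Rank–nullity for `g` restricted to `ker (f * g)`: its image lies in `ker f`, its kernel in `ker
g`. -/
theorem finrank_ker_mul_le (f g : End ℂ V) :
    finrank ℂ (LinearMap.ker (f * g)) ≤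
      finrank ℂ (LinearMap.ker f) + finrank ℂ (LinearMap.ker g) := by
  let h : LinearMap.ker (f * g) →ₗ[ℂ] LinearMap.ker f :=
    g.restrict fun v hv => hv
  have h1 := h.finrank_range_add_finrank_ker
  have h2 : finrank ℂ (LinearMap.range h) ≤ finrank ℂ (LinearMap.ker f) :=
    Submodule.finrank_le _
  have h3 : finrank ℂ (LinearMap.ker h) ≤ finrank ℂ (LinearMap.ker g) := by
    refine LinearMap.finrank_le_finrank_of_injective
      (f := (((LinearMap.ker (f * g)).subtype.comp (LinearMap.ker h).subtype).codRestrict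
        (LinearMap.ker g) fun v => ?_)) ?_
    · exact congrArg Subtype.val v.2
    · intro v w hvw
      exact Subtype.ext (Subtype.ext (congrArg (fun z : LinearMap.ker g => (z : V)) hvw))
  omega

theorem finrank_ker_prod_sub_le (f : End ℂ V) (s : Multiset ℂ) :
    finrank ℂ (LinearMap.ker (aeval f (s.map fun r => X - C r).prod)) ≤
      (s.map fun r => finrank ℂ (f.eigenspace r)).sum := by
  induction s using Multiset.induction with
  | empty =>
    rw [Multiset.map_zero, Multiset.prod_zero, map_one, End.one_eq_id, LinearMap.ker_id,
      finrank_bot]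
    exact Nat.zero_le _
  | cons a s ih =>
    rw [Multiset.map_cons, Multiset.prod_cons, map_mul, Multiset.map_cons, Multiset.sum_cons]
    refine (finrank_ker_mul_le _ _).trans (Nat.add_le_add (le_of_eq ?_) ih)
    rw [End.eigenspace_def, map_sub, aeval_X, aeval_C, Algebra.algebraMap_eq_smul_one]

/-- An operator with `f ^ d` scalar has an eigenspace of dimension at least `dim V / d`. -/
theorem exists_finrank_le_mul_eigenspace {d : ℕ} (hd : 0 < d) (f : End ℂ V) {c : ℂ}
    (hf : f ^ d = c • (1 : End ℂ V)) : ∃ μ, finrank ℂ V ≤ d * finrank ℂ (f.eigenspace μ) := by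
  let p : ℂ[X] := X ^ d - C c
  -- The polynomial annihilates `f` and splits into linear factors, so the eigenspace dimensions
  -- over its `d` roots with multiplicity sum to at least `dim V`; one is at least average.
  have hp : p.Monic := monic_X_pow_sub_C c hd.ne'
  have hsplit := IsAlgClosed.splits p
  have hprod : (p.roots.map fun r => X - C r).prod = p := by
    exact (hsplit.eq_prod_roots_of_monic hp).symm
  have hker : LinearMap.ker (aeval f (p.roots.map fun r => X - C r).prod) = ⊤ := by
    rw [hprod]
    simp [p, hf, Algebra.algebraMap_eq_smul_one]
  have h1 := finrank_ker_prod_sub_le f p.roots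
  rw [hker, finrank_top] at h1
  by_contra! hcon
  have hcard : Multiset.card p.roots ≤ d := by
    refine (card_roots' p).trans (le_of_eq (natDegree_X_pow_sub_C))
  rcases Nat.eq_zero_or_pos (finrank ℂ V) with h0 | h0
  · exact absurd (hcon 0) (by omega)
  have h2 : (p.roots.map fun r => d * finrank ℂ (f.eigenspace r)).sum ≤
      Multiset.card p.roots • (finrank ℂ V - 1) := by
    have := Multiset.sum_le_card_nsmul (p.roots.map fun r => d * finrank ℂ (f.eigenspace r))
      (finrank ℂ V - 1) (by
        intro x hx
        obtain ⟨r, -, rfl⟩ := Multiset.mem_map.1 hx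
        have := hcon r
        omega)
    simpa using this
  rw [Multiset.sum_map_mul_left, smul_eq_mul] at h2
  have h3 : d * finrank ℂ V ≤ d * (finrank ℂ V - 1) :=
    (Nat.mul_le_mul_left d h1).trans (h2.trans (Nat.mul_le_mul_right _ hcard))
  have := Nat.le_of_mul_le_mul_left h3 hd
  omega

/-- Commuting operators with scalar `d`-th powers have a large joint eigenspace. -/
theorem exists_joint_eigenspace {d : ℕ} (hd : 0 < d) (m : ℕ) (f : Fin m → End ℂ V)
    (hcomm : ∀ i j, Commute (f i) (f j)) (hf : ∀ i, ∃ c : ℂ, f i ^ d = c • (1 : End ℂ V)) :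
    ∃ W : Submodule ℂ V, finrank ℂ V ≤ d ^ m * finrank ℂ W ∧
      (∀ i, ∃ μ : ℂ, ∀ v ∈ W, f i v = μ • v) ∧
      ∀ g : End ℂ V, (∀ i, Commute g (f i)) → ∀ v ∈ W, g v ∈ W := by
  induction m with
  | zero => exact ⟨⊤, by simp, fun i => i.elim0, fun _ _ _ _ => trivial⟩
  | succ m ih =>
    obtain ⟨W, hW, heig, hinv⟩ := ih (fun i => f i.castSucc) (fun i j => hcomm _ _)
      (fun i => hf _)
    -- Carrying invariance under the commutant through the induction is what lets the last operator
    -- be restricted to `W`.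
    have hfW : ∀ v ∈ W, f (Fin.last m) v ∈ W := hinv _ fun i => hcomm _ _
    obtain ⟨c, hc⟩ := hf (Fin.last m)
    let g : End ℂ W := (f (Fin.last m)).restrict hfW
    have hg : g ^ d = c • (1 : End ℂ W) := by
      ext v
      have h := LinearMap.congr_fun hc (v : V)
      have hpow : ∀ (k : ℕ) (v : W), (((g ^ k) v : W) : V) = (f (Fin.last m) ^ k) v := by
        intro k
        induction k with
        | zero => simp
        | succ k ihk =>
          intro v
          rw [pow_succ, pow_succ, End.mul_apply, End.mul_apply, ihk]
          rfl
      rw [hpow, h]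
      rfl
    obtain ⟨μ, hμ⟩ := exists_finrank_le_mul_eigenspace hd g hg
    refine ⟨(g.eigenspace μ).map W.subtype, ?_, ?_, ?_⟩
    · rw [Submodule.finrank_map_subtype_eq, pow_succ, mul_assoc]
      exact hW.trans (Nat.mul_le_mul_left _ hμ)
    · intro i
      refine Fin.lastCases ⟨μ, ?_⟩ (fun j => ?_) i
      · rintro _ ⟨v, hv, rfl⟩
        exact congrArg Subtype.val (End.mem_eigenspace_iff.1 hv)
      · obtain ⟨ν, hν⟩ := heig j
        refine ⟨ν, ?_⟩
        rintro _ ⟨v, -, rfl⟩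
        exact hν v v.2
    · rintro k hk _ ⟨v, hv, rfl⟩
      have hkW := hinv k (fun i => hk _) v v.2
      refine ⟨⟨k v, hkW⟩, ?_, rfl⟩
      refine End.mem_eigenspace_iff.2 (Subtype.ext ?_)
      have h1 := LinearMap.congr_fun (hk (Fin.last m)).eq (v : V)
      have h2 : f (Fin.last m) v = μ • (v : V) :=
        congrArg Subtype.val (End.mem_eigenspace_iff.1 hv)
      rw [End.mul_apply, End.mul_apply, h2, map_smul] at h1
      exact h1.symm

end Eigenspaces

/-! ### Random stabilizer codes. -/

section Stabilizer

/-- A family of `m ≤ n` commuting matrices, all of whose nontrivial combinations are invertible. -/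
theorem exists_commuting_matrices (d : ℕ) [Fact d.Prime] {n m : ℕ} (hn : n ≠ 0) (hm : m ≤ n) :
    ∃ M : Fin m → Matrix (Fin n) (Fin n) (ZMod d), (∀ i j, Commute (M i) (M j)) ∧
      ∀ l : Fin m → ZMod d, l ≠ 0 → IsUnit (∑ i, l i • M i) := by
  -- The matrices are multiplications by basis elements of the field with `d ^ n` elements: they
  -- commute, and a nontrivial combination is multiplication by a nonzero field element.
  let b : Module.Basis (Fin n) (ZMod d) (GaloisField d n) :=
    Module.finBasisOfFinrankEq _ _ (GaloisField.finrank d hn)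
  let φ := Algebra.leftMulMatrix b
  refine ⟨fun i => φ (b (Fin.castLE hm i)), fun i j => (Commute.all _ _).map φ, fun l hl => ?_⟩
  have h : ∑ i, l i • φ (b (Fin.castLE hm i)) = φ (∑ i, l i • b (Fin.castLE hm i)) := by
    simp only [map_sum, map_smul]
  rw [h]
  refine IsUnit.map φ (isUnit_iff_ne_zero.2 fun h0 => hl ?_)
  have hli : LinearIndependent (ZMod d) fun i => b (Fin.castLE hm i) :=
    b.linearIndependent.comp _ (Fin.castLE_injective hm)
  exact funext (Fintype.linearIndependent_iff.1 hli l h0)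

variable {d n m : ℕ}

/-- The stabilizer generators determined by commuting matrices `M i` and vectors `c`, `e`. -/
def stabGen (M : Fin m → Matrix (Fin n) (Fin n) (ZMod d))
    (u : (Fin n → ZMod d) × (Fin n → ZMod d)) (i : Fin m) : Fin n → Lbl d :=
  fun k => ((M i *ᵥ u.1) k, (u.2 ᵥ* M i) k)

theorem sympl_stabGen (M : Fin m → Matrix (Fin n) (Fin n) (ZMod d))
    (u : (Fin n → ZMod d) × (Fin n → ZMod d)) (i : Fin m) (w : Fin n → Lbl d) :
    sympl (stabGen M u i) w = zPart w ⬝ᵥ (M i *ᵥ u.1) - u.2 ⬝ᵥ (M i *ᵥ xPart w) := by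
  have h1 : xPart (stabGen M u i) = M i *ᵥ u.1 := rfl
  have h2 : zPart (stabGen M u i) = u.2 ᵥ* M i := rfl
  rw [sympl, h1, h2, dotProduct_comm, dotProduct_mulVec u.2, dotProduct_comm (xPart w)]

theorem sympl_stabGen_stabGen {M : Fin m → Matrix (Fin n) (Fin n) (ZMod d)}
    (hM : ∀ i j, Commute (M i) (M j)) (u : (Fin n → ZMod d) × (Fin n → ZMod d)) (i j : Fin m) :
    sympl (stabGen M u i) (stabGen M u j) = 0 := by
  have h1 : xPart (stabGen M u j) = M j *ᵥ u.1 := rfl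
  have h2 : zPart (stabGen M u j) = u.2 ᵥ* M j := rfl
  rw [sympl_stabGen, h1, h2, ← dotProduct_mulVec, mulVec_mulVec, mulVec_mulVec, (hM i j).eq,
    sub_self]

/-- The syndrome of `w` as a linear function of the code parameters. -/
def syndromeMap (M : Fin m → Matrix (Fin n) (Fin n) (ZMod d)) (w : Fin n → Lbl d) :
    ((Fin n → ZMod d) × (Fin n → ZMod d)) →ₗ[ZMod d] (Fin m → ZMod d) where
  toFun u i := sympl (stabGen M u i) w
  map_add' u v := by
    ext i
    simp only [sympl_stabGen, Prod.fst_add, Prod.snd_add, mulVec_add, dotProduct_add,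
      add_dotProduct, Pi.add_apply]
    ring
  map_smul' c u := by
    ext i
    simp only [sympl_stabGen, Prod.smul_fst, Prod.smul_snd, mulVec_smul, dotProduct_smul,
      smul_dotProduct, Pi.smul_apply, RingHom.id_apply, smul_eq_mul]
    ring

theorem sum_mul_syndromeMap (M : Fin m → Matrix (Fin n) (Fin n) (ZMod d)) (w : Fin n → Lbl d)
    (l : Fin m → ZMod d) (u : (Fin n → ZMod d) × (Fin n → ZMod d)) :
    ∑ i, l i * syndromeMap M w u i =
      zPart w ⬝ᵥ ((∑ i, l i • M i) *ᵥ u.1) - u.2 ⬝ᵥ ((∑ i, l i • M i) *ᵥ xPart w) := by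
  simp only [sum_mulVec, smul_mulVec, dotProduct_sum, dotProduct_smul, ← Finset.sum_sub_distrib,
    smul_eq_mul, ← mul_sub]
  exact Finset.sum_congr rfl fun i _ => congrArg (l i * ·) (sympl_stabGen M u i w)

/-- A proper image would be killed by a nonzero functional `l`. Then `U = ∑ i, l i • M i` is
invertible, and testing the vanishing form with `(0, e)` and `(c, 0)` kills both parts of `w`. -/
theorem syndromeMap_surjective [Fact d.Prime] {M : Fin m → Matrix (Fin n) (Fin n) (ZMod d)}
    (hM : ∀ l : Fin m → ZMod d, l ≠ 0 → IsUnit (∑ i, l i • M i)) {w : Fin n → Lbl d}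
    (hw : w ≠ 0) : Function.Surjective (syndromeMap M w) := by
  rw [← LinearMap.range_eq_top]
  by_contra hne
  obtain ⟨f, hf0, hf⟩ := Submodule.exists_le_ker_of_lt_top _ (lt_top_iff_ne_top.2 hne)
  let l : Fin m → ZMod d := fun i => f (Pi.single i 1)
  have hfl : ∀ y, f y = ∑ i, l i * y i := by
    intro y
    conv_lhs => rw [pi_eq_sum_univ' y]
    simp [l, mul_comm]
  have hl : l ≠ 0 := by
    rintro h0
    refine hf0 (LinearMap.ext fun y => ?_)
    rw [hfl, h0]
    simp
  have hU := hM l hl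
  set U := ∑ i, l i • M i with hUdef
  have h0 : ∀ u : (Fin n → ZMod d) × (Fin n → ZMod d),
      zPart w ⬝ᵥ (U *ᵥ u.1) - u.2 ⬝ᵥ (U *ᵥ xPart w) = 0 := by
    intro u
    rw [hUdef, ← sum_mul_syndromeMap, ← hfl]
    exact hf ⟨u, rfl⟩
  have hx : xPart w = 0 := by
    have h1 : U *ᵥ xPart w = 0 := by
      refine dotProduct_eq_zero _ fun e => ?_
      have := h0 (0, e)
      simp only [mulVec_zero, dotProduct_zero, zero_sub, neg_eq_zero] at this
      rw [dotProduct_comm, this]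
    exact mulVec_injective_iff_isUnit.2 hU (by rw [h1, mulVec_zero])
  have hz : zPart w = 0 := by
    have h1 : zPart w ᵥ* U = 0 := by
      refine dotProduct_eq_zero _ fun c => ?_
      have := h0 (c, 0)
      simp only [zero_dotProduct, sub_zero] at this
      rw [← dotProduct_mulVec, this]
    exact vecMul_injective_iff_isUnit.2 hU (by simp only [h1, zero_vecMul])
  exact hw (funext fun k => Prod.ext (congrFun hx k) (congrFun hz k))

/-- Surjectivity gives the kernel index `d ^ m`: uniformly random parameters annihilate a fixed
nonzero error with probability `d ^ (-m)`. -/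
theorem card_syndromeMap_eq_zero [Fact d.Prime]
    {M : Fin m → Matrix (Fin n) (Fin n) (ZMod d)}
    (hM : ∀ l : Fin m → ZMod d, l ≠ 0 → IsUnit (∑ i, l i • M i)) {w : Fin n → Lbl d}
    (hw : w ≠ 0) :
    (Finset.univ.filter fun u => syndromeMap M w u = 0).card * d ^ m =
      Fintype.card ((Fin n → ZMod d) × (Fin n → ZMod d)) := by
  classical
  have h1 := Submodule.card_eq_card_quotient_mul_card (LinearMap.ker (syndromeMap M w))
  have h2 := Nat.card_congr
    ((syndromeMap M w).quotKerEquivOfSurjective (syndromeMap_surjective hM hw)).toEquiv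
  have h3 : Nat.card (LinearMap.ker (syndromeMap M w)) =
      (Finset.univ.filter fun u => syndromeMap M w u = 0).card := by
    rw [← Fintype.card_subtype, ← Nat.card_eq_fintype_card]
    rfl
  have h4 : Nat.card (Fin m → ZMod d) = d ^ m := by
    rw [Nat.card_eq_fintype_card, Fintype.card_fun, ZMod.card, Fintype.card_fin]
  rw [← Nat.card_eq_fintype_card, h1, h2, h3, h4]

open Classical in
/-- The errors of `T` that the stabilizer code with parameters `u` confuses with others of `T`. -/
noncomputable def confused (M : Fin m → Matrix (Fin n) (Fin n) (ZMod d))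
    (T : Finset (Fin n → Lbl d)) (u : (Fin n → ZMod d) × (Fin n → ZMod d)) :
    Finset (Fin n → Lbl d) :=
  {x ∈ T | ∃ y ∈ T, x ≠ y ∧ syndromeMap M (x - y) u = 0}

/-- Random coding: some code of the family confuses few errors. -/
theorem exists_sum_confused_le [Fact d.Prime]
    {M : Fin m → Matrix (Fin n) (Fin n) (ZMod d)}
    (hM : ∀ l : Fin m → ZMod d, l ≠ 0 → IsUnit (∑ i, l i • M i)) (T : Finset (Fin n → Lbl d))
    {w : (Fin n → Lbl d) → ℝ} (hw : ∀ x, 0 ≤ w x) (hw1 : ∑ x ∈ T, w x ≤ 1) :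
    ∃ u, ∑ x ∈ confused M T u, w x ≤ T.card / (d : ℝ) ^ m := by
  classical
  have hd : (0 : ℝ) < (d : ℝ) ^ m := by
    have : 0 < d := (Fact.out : d.Prime).pos
    positivity
  let U := (Fin n → ZMod d) × (Fin n → ZMod d)
  have hcount : ∀ x y : Fin n → Lbl d, x ≠ y →
      ∑ u : U, (if syndromeMap M (x - y) u = 0 then (1 : ℝ) else 0) =
        Fintype.card U / (d : ℝ) ^ m := by
    intro x y hxy
    rw [Finset.sum_boole, eq_div_iff hd.ne']
    exact_mod_cast card_syndromeMap_eq_zero hM (sub_ne_zero.2 hxy)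
  -- Union bound: the indicator of being confused is at most the number of errors sharing the
  -- syndrome.
  have hpt : ∀ u : U, ∑ x ∈ confused M T u, w x ≤ ∑ x ∈ T, w x * ∑ y ∈ T with x ≠ y,
      (if syndromeMap M (x - y) u = 0 then (1 : ℝ) else 0) := by
    intro u
    rw [confused, Finset.sum_filter]
    refine Finset.sum_le_sum fun x _ => ?_
    split_ifs with h
    · obtain ⟨y, hy, hxy, h0⟩ := h
      refine le_mul_of_one_le_right (hw x) ?_
      have := Finset.single_le_sum (s := T.filter fun y => x ≠ y)
        (f := fun y => if syndromeMap M (x - y) u = 0 then (1 : ℝ) else 0)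
        (fun _ _ => by positivity) (Finset.mem_filter.2 ⟨hy, hxy⟩)
      simpa [h0] using this
    · exact mul_nonneg (hw x) (Finset.sum_nonneg fun _ _ => by positivity)
  have hsum : ∑ u : U, ∑ x ∈ confused M T u, w x ≤
      ∑ _u : U, (T.card / (d : ℝ) ^ m : ℝ) := by
    refine (Finset.sum_le_sum fun u _ => hpt u).trans ?_
    rw [Finset.sum_comm]
    have h1 : ∀ x ∈ T, ∑ u : U, w x * ∑ y ∈ T with x ≠ y,
        (if syndromeMap M (x - y) u = 0 then (1 : ℝ) else 0) ≤
        w x * (T.card * (Fintype.card U / (d : ℝ) ^ m)) := by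
      intro x _
      rw [← Finset.mul_sum, Finset.sum_comm]
      refine mul_le_mul_of_nonneg_left ?_ (hw x)
      rw [Finset.sum_congr rfl fun y hy => hcount x y (Finset.mem_filter.1 hy).2,
        Finset.sum_const, nsmul_eq_mul]
      exact mul_le_mul_of_nonneg_right (by exact_mod_cast Finset.card_filter_le _ _)
        (by positivity)
    refine (Finset.sum_le_sum h1).trans ?_
    rw [← Finset.sum_mul, Finset.sum_const, Finset.card_univ, nsmul_eq_mul]
    calc (∑ x ∈ T, w x) * (T.card * (Fintype.card U / (d : ℝ) ^ m))
        ≤ 1 * (T.card * (Fintype.card U / (d : ℝ) ^ m)) :=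
          mul_le_mul_of_nonneg_right hw1 (by positivity)
      _ = _ := by ring
  obtain ⟨u, -, hu⟩ := Finset.exists_le_of_sum_le Finset.univ_nonempty hsum
  exact ⟨u, hu⟩

/-- Existence of good stabilizer codes for channels with Weyl errors. -/
theorem exists_code [Fact d.Prime] {ω : ℂ} (hω : IsPrimitiveRoot ω d) (hn : n ≠ 0) (hm : m ≤ n)
    (T : Finset (Fin n → Lbl d)) {w : (Fin n → Lbl d) → ℝ} (hw : ∀ x, 0 ≤ w x)
    (hw1 : ∑ x ∈ T, w x ≤ 1) :
    ∃ (C : Submodule ℂ (EuclideanSpace ℂ (Fin n → ZMod d))) (ℛ : OpMap d n),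
      d ^ n ≤ d ^ m * Module.finrank ℂ C ∧ IsTPCP ℛ ∧ ∀ ψ ∈ C, ‖ψ‖ = 1 →
        ∑ x ∈ T, w x - T.card / (d : ℝ) ^ m ≤ pureFidelity
          (ℛ ∘ₗ operatorSum fun x => ((√(w x) : ℝ) : ℂ) • weylTensor d ω n x) ψ := by
  classical
  obtain ⟨M, hcomm, hM⟩ := exists_commuting_matrices d hn hm
  obtain ⟨u, hu⟩ := exists_sum_confused_le hM T hw hw1
  let φ := toLinAlgEquiv' (R := ℂ) (n := Fin n → ZMod d)
  -- The generators may be dependent for this `u`; the dimension bound holds regardless, and any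
  -- joint eigenvalues serve.
  obtain ⟨W, hW, heig, -⟩ := exists_joint_eigenspace (Fact.out : d.Prime).pos m
    (fun i => φ (weylTensor d ω n (stabGen M u i)))
    (fun i j => (weylTensor_commute hω.pow_eq_one (sympl_stabGen_stabGen hcomm u i j)).map φ)
    (fun i => by
      obtain ⟨c, hc⟩ := exists_weylTensor_pow hω.pow_eq_one (stabGen M u i)
      exact ⟨c, by rw [← map_pow, hc, map_smul, map_one]⟩)
  let e := WithLp.linearEquiv 2 ℂ ((Fin n → ZMod d) → ℂ)
  let C : Submodule ℂ (EuclideanSpace ℂ (Fin n → ZMod d)) := W.map e.symm.toLinearMap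
  have hC : ∀ v ∈ C, v.ofLp ∈ W := by
    rintro _ ⟨v, hv, rfl⟩
    exact hv
  have heigC : ∀ i, ∃ μ : ℂ, ∀ v ∈ C,
      weylTensor d ω n (stabGen M u i) *ᵥ v.ofLp = μ • v.ofLp := by
    intro i
    obtain ⟨μ, hμ⟩ := heig i
    exact ⟨μ, fun v hv => hμ _ (hC v hv)⟩
  obtain ⟨ℛ, hℛ, hfid⟩ := exists_recovery (fun x => weylTensor d ω n x)
    (weylTensor_conjTranspose_mul_self hω.pow_eq_one) hw (T \ confused M T u) C (by
      intro x hx y hy hxy v hv v' hv'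
      have hne : syndromeMap M (y - x) u ≠ 0 := by
        intro h0
        refine (Finset.mem_sdiff.1 hy).2 ?_
        exact Finset.mem_filter.2
          ⟨(Finset.mem_sdiff.1 hy).1, x, (Finset.mem_sdiff.1 hx).1, hxy.symm, h0⟩
      obtain ⟨i, hi⟩ := Function.ne_iff.1 hne
      obtain ⟨μ, hμ⟩ := heigC i
      exact weylTensor_orthogonal hω hi (hμ v hv) (hμ v' hv'))
  refine ⟨C, ℛ, ?_, hℛ, fun ψ hψ hψ1 => le_trans ?_ (hfid ψ hψ hψ1)⟩
  · have h1 : Module.finrank ℂ C = Module.finrank ℂ W := LinearEquiv.finrank_map_eq e.symm W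
    rw [h1]
    refine le_trans (le_of_eq ?_) hW
    rw [Module.finrank_fintype_fun_eq_card, Fintype.card_fun, ZMod.card, Fintype.card_fin]
  · have h1 : confused M T u ⊆ T := Finset.filter_subset _ _
    have h2 := Finset.sum_sdiff (f := w) h1
    linarith

end Stabilizer

/-! ### Achievable rates and the capacity bound. -/

section Capacity

theorem condEntropy_nonneg {α : Type} [Fintype α] [DecidableEq α] {P : Matrix α α ℝ}
    (hP : P ∈ rowStochastic ℝ α) {d : ℕ} (hd : 1 < d) (q : α → ℝ) : 0 ≤ condEntropy d P q := by
  rw [condEntropy, neg_nonneg]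
  refine Finset.sum_nonpos fun u hu => Finset.sum_nonpos fun v _ => ?_
  have hnn : 0 ≤ P u v := nonneg_of_mem_rowStochastic hP
  exact mul_nonpos_of_nonneg_of_nonpos (mul_nonneg (Finset.mem_filter.1 hu).2.le hnn)
    (Real.logb_nonpos (by exact_mod_cast hd) hnn (le_one_of_mem_rowStochastic hP))

/-- The rate zero is achievable over any channel: one-dimensional codes are preserved by
the constant recovery. -/
theorem isAchievable_zero {d : ℕ} [NeZero d] {𝒜 : ∀ n : ℕ, OpMap d n}
    (h𝒜 : ∀ n, IsTPCP (𝒜 n)) : IsAchievable d 𝒜 0 := by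
  classical
  refine ⟨le_rfl, tendsto_const_nhds.congr fun n => ?_⟩
  -- These Kraus operators replace every input by `tr ρ` times the projection onto the basis vector
  -- spanning the code.
  let K : (Fin n → ZMod d) → Matrix (Fin n → ZMod d) (Fin n → ZMod d) ℂ :=
    fun a => Matrix.single 0 a 1
  have hK : ∑ a, (K a)ᴴ * K a = 1 := by
    simp only [K, conjTranspose_single, star_one, single_mul_single_same, mul_one]
    ext a b
    simp [Matrix.sum_apply, Matrix.single_apply, one_apply, ite_and]
  let ψ₀ : EuclideanSpace ℂ (Fin n → ZMod d) := EuclideanSpace.single 0 1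
  have hψ₀ : ψ₀ ≠ 0 := by
    rw [← norm_ne_zero_iff]
    simp [ψ₀]
  refine le_antisymm (le_optFidelity (h𝒜 n) (isTPCP_operatorSum K hK)
    (C := Submodule.span ℂ {ψ₀}) ?_ ?_ ?_) (optFidelity_le_one (h𝒜 n))
  · simpa using hψ₀
  · rw [finrank_span_singleton hψ₀]
    simp
  · intro ψ hψ hψ1
    obtain ⟨c, rfl⟩ := Submodule.mem_span_singleton.1 hψ
    have hρ : ∀ ρ, operatorSum K ρ = ρ.trace • Matrix.single 0 0 1 := by
      intro ρ
      rw [operatorSum_apply]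
      simp only [K, conjTranspose_single, star_one, single_mul_mul_single, one_mul, mul_one,
        Matrix.trace, Finset.sum_smul, diag_apply, smul_single, smul_eq_mul]
    have hc := star_dotProduct_self_of_norm_eq_one hψ1
    refine le_of_eq ?_
    have h0 : Matrix.single 0 0 1 *ᵥ (c • ψ₀).ofLp = (c • ψ₀).ofLp := by
      ext a
      rw [single_mulVec]
      simp [ψ₀, Function.update_apply]
    rw [pureFidelity, LinearMap.comp_apply, hρ, (h𝒜 n).2, trace_vecMulVec,
      dotProduct_comm (c • ψ₀).ofLp, hc, one_smul, h0, hc, Complex.one_re]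

theorem isAchievable_markovChannel {d : ℕ} [Fact d.Prime] {ω : ℂ} (hω : IsPrimitiveRoot ω d)
    {P : Matrix (Lbl d) (Lbl d) ℝ} (hP : P ∈ rowStochastic ℝ (Lbl d)) (hirr : P.IsIrreducible)
    {p : Lbl d → ℝ} (hp : p ∈ stdSimplex ℝ (Lbl d)) {q : Lbl d → ℝ} (hq : IsStationary P q)
    {R : ℝ} (hR0 : 0 ≤ R) (hR : R < 1 - condEntropy d P q) :
    IsAchievable d (markovChannel d ω p P) R := by
  have hd : 1 < d := (Fact.out : d.Prime).one_lt
  have hd' : (1 : ℝ) < d := by exact_mod_cast hd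
  have hd0 : (0 : ℝ) < d := by linarith
  have hH := condEntropy_nonneg hP hd q
  obtain ⟨h, hh1, hh2⟩ : ∃ h, condEntropy d P q < h ∧ h < 1 - R := exists_between (by linarith)
  have hR1 : R ≤ 1 := by linarith
  refine ⟨hR0, (tendsto_add_atTop_iff_nat 1).1 ?_⟩
  let δ : ℝ := 1 - R - h
  -- An upper bound for `|T| / d ^ m` with `m = n + 1 - k`; the factor `d` absorbs the shift between
  -- `n` transitions and block length `n + 1`.
  let err : ℕ → ℝ := fun n => Fintype.card (Lbl d) * d * ((d : ℝ) ^ (-δ)) ^ n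
  have herr : Tendsto err atTop (𝓝 0) := by
    have h1 : (d : ℝ) ^ (-δ) < 1 :=
      Real.rpow_lt_one_of_one_lt_of_neg hd' (by simp only [δ]; linarith)
    have := (tendsto_pow_atTop_nhds_zero_of_lt_one (by positivity) h1).const_mul
      ((Fintype.card (Lbl d) : ℝ) * d)
    rwa [mul_zero] at this
  have hlow := (tendsto_sum_typicalSet hP hirr hp hq hd hh1).sub herr
  rw [sub_zero] at hlow
  refine tendsto_of_tendsto_of_tendsto_of_le_of_le hlow tendsto_const_nhds (fun n => ?_)
    fun n => optFidelity_le_one (isTPCP_markovChannel hω.pow_eq_one hP hp _)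
  let k := ⌈R * ((n + 1 : ℕ) : ℝ)⌉₊
  have hk : k ≤ n + 1 := Nat.ceil_le.2 (mul_le_of_le_one_left (by positivity) hR1)
  have hkR : R * ((n + 1 : ℕ) : ℝ) ≤ k := Nat.le_ceil _
  have hkR' : (k : ℝ) < R * ((n + 1 : ℕ) : ℝ) + 1 := Nat.ceil_lt_add_one (by positivity)
  let T := typicalSet d P h n
  obtain ⟨C, ℛ, hdim, hℛ, hfid⟩ := exists_code hω (Nat.succ_ne_zero n)
    (Nat.sub_le (n + 1) k) T (markovDist_nonneg hP hp (n + 1)) (by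
      rw [← sum_markovDist hP hp (n + 1)]
      exact Finset.sum_le_sum_of_subset_of_nonneg (Finset.subset_univ _) fun x _ _ =>
        markovDist_nonneg hP hp _ x)
  have hdimk : d ^ k ≤ Module.finrank ℂ C := by
    have h1 : d ^ (n + 1) = d ^ (n + 1 - k) * d ^ k := by
      rw [← pow_add, Nat.sub_add_cancel hk]
    rw [h1] at hdim
    exact Nat.le_of_mul_le_mul_left hdim (by positivity)
  have hCne : C ≠ ⊥ := by
    rintro rfl
    rw [finrank_bot] at hdimk
    exact absurd hdimk (not_le.2 (by positivity))
  refine le_optFidelity (isTPCP_markovChannel hω.pow_eq_one hP hp _) hℛ hCne ?_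
    fun ψ hψ hψ1 => le_trans (sub_le_sub_left ?_ _) (hfid ψ hψ hψ1)
  · refine hkR.trans ?_
    rw [Real.le_logb_iff_rpow_le hd' (by
      exact_mod_cast lt_of_lt_of_le (by positivity) hdimk), Real.rpow_natCast]
    exact_mod_cast hdimk
  · have hcard := card_typicalSet_le hP (zero_lt_one.trans hd) h n
    -- The extra letter of the block pays for rounding `k` up; what remains is `R - δ * n`, and `R ≤
    -- 1`.
    have hexp : (n : ℝ) * h - ((n + 1 - k : ℕ) : ℝ) ≤ 1 + -δ * n := by
      rw [Nat.cast_sub hk]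
      push_cast at hkR' ⊢
      simp only [δ]
      nlinarith
    calc (T.card : ℝ) / (d : ℝ) ^ (n + 1 - k)
        ≤ Fintype.card (Lbl d) * (d : ℝ) ^ (n * h) / (d : ℝ) ^ (n + 1 - k) := by
          gcongr
      _ = Fintype.card (Lbl d) * (d : ℝ) ^ (n * h - ((n + 1 - k : ℕ) : ℝ)) := by
          rw [Real.rpow_sub hd0, Real.rpow_natCast, mul_div_assoc]
      _ ≤ Fintype.card (Lbl d) * (d : ℝ) ^ (1 + -δ * n) := by
          gcongr
          exact hd'.le
      _ = err n := by
          simp only [err]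
          rw [Real.rpow_add hd0, Real.rpow_one, Real.rpow_mul hd0.le, Real.rpow_natCast, mul_assoc]

theorem le_quantumCapacity_markovChannel {d : ℕ} [Fact d.Prime] {ω : ℂ}
    (hω : IsPrimitiveRoot ω d) {P : Matrix (Lbl d) (Lbl d) ℝ}
    (hP : P ∈ rowStochastic ℝ (Lbl d)) (hirr : P.IsIrreducible)
    {p : Lbl d → ℝ} (hp : p ∈ stdSimplex ℝ (Lbl d)) {q : Lbl d → ℝ} (hq : IsStationary P q) :
    ((1 - condEntropy d P q : ℝ) : EReal) ≤ quantumCapacity d (markovChannel d ω p P) := by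
  have hle : ∀ R, IsAchievable d (markovChannel d ω p P) R →
      (R : EReal) ≤ quantumCapacity d (markovChannel d ω p P) := fun R hR => by
    rw [quantumCapacity]
    exact le_iSup₂_of_le R hR le_rfl
  -- Rate zero is needed for the negative reals below the bound, in particular when `1 - H(P|q) ≤
  -- 0`: the supremum ranges over nonnegative rates and would be `⊥` if none were achievable.
  have h0 := hle 0 (isAchievable_zero fun n => isTPCP_markovChannel hω.pow_eq_one hP hp n)
  refine EReal.ge_of_forall_gt_iff_ge.1 fun R hR => ?_
  rcases le_total 0 R with hR0 | hR0
  · exact hle R (isAchievable_markovChannel hω hP hirr hp hq hR0 (by exact_mod_cast hR))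
  · exact le_trans (by exact_mod_cast hR0) h0

end Capacity

end MarkovChannel

theorem mainTheorem3 (d : ℕ) [Fact d.Prime] (ω : ℂ) (hω : IsPrimitiveRoot ω d)
    (P : Matrix (MarkovChannel.Lbl d) (MarkovChannel.Lbl d) ℝ)
    (hP : P ∈ Matrix.rowStochastic ℝ (MarkovChannel.Lbl d)) (hirr : P.IsIrreducible)
    (p : MarkovChannel.Lbl d → ℝ) (hp : p ∈ stdSimplex ℝ (MarkovChannel.Lbl d)) :
    (∃! q, MarkovChannel.IsStationary P q) ∧
    ∀ q, MarkovChannel.IsStationary P q →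
      (∀ Q ∈ stdSimplex ℝ (MarkovChannel.Lbl d × MarkovChannel.Lbl d),
        MarkovChannel.marg₁ Q = MarkovChannel.marg₂ Q →
          0 ≤ MarkovChannel.condKL d Q P ∧
          (MarkovChannel.condKL d Q P = 0 ↔ ∀ u v, Q (u, v) = q u * P u v)) ∧
      (∀ R : ℝ, R < 1 - MarkovChannel.condEntropy d P q →
        0 < MarkovChannel.errorExponent d R P) ∧
      ((1 - MarkovChannel.condEntropy d P q : ℝ) : EReal) ≤
        MarkovChannel.quantumCapacity d (MarkovChannel.markovChannel d ω p P) := by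
  have hd : 1 < d := (Fact.out : d.Prime).one_lt
  refine ⟨MarkovChannel.existsUnique_isStationary hP hirr, fun q hq => ⟨fun Q hQ hm => ?_,
    fun R hR => ?_, ?_⟩⟩
  · exact MarkovChannel.condKL_nonneg_and_eq_zero_iff hd hP hirr hq hQ hm
  · exact MarkovChannel.errorExponent_pos hd hP hirr hq hR
  · exact MarkovChannel.le_quantumCapacity_markovChannel hω hP hirr hp hq
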